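/- \textbf{Theorem (Topological expansion).} Let $N\ge 1$ be an integer and, for real $t>0$, let $\langle\cdot\rangle$ denote the expectation with respect to the Gaussian probability measure proportional to $e^{-N\,\mathrm{Tr}\,M^2/(2t)}\,dM$ on the space of $N\times N$ Hermitian matrices, $dM$ being the Lebesgue measure. Let $v_1,v_2,\dots$ be formal variables, $V(x)=\sum_{n\ge1}\frac{v_n}{n}x^n$, and view $e^{N\,\mathrm{Tr}\,V(M)}$ as a formal power series in the $v_n$ whose coefficients are polynomials in the entries of $M$. Define the partition function $\Xi_N(t,V)=\langle e^{N\,\mathrm{Tr}\,V(M)}\rangle$, where the expectation acts coefficientwise, and the free energy $F_N(t,V)=\log\Xi_N(t,V)$, a formal power series in the $v_n$. A labelled map with $m\ge1$ edges is a pair $(\sigma,\alpha)$ of permutations of $\{1,\dots,2m\}$ such that $\alpha$ is an involution without fixed point and the group generated by $\sigma$ and $\alpha$ acts transitively on $\{1,\dots,2m\}$. Write $c_n(\sigma)$ for the number of cycles of length $n$ of $\sigma$ and $c(\sigma)$ for its total number of cycles, fixed points being cycles of length $1$. The vertices of the map are the cycles of $\sigma$, the degree of a vertex is the length of the cycle,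 and the genus $g$ of the map is defined by $c(\sigma)-c(\alpha)+c(\sigma\circ\alpha)=2-2g$. Let $$F^{(g)}(t,V)=\sum_{m\ge1}\frac{t^m}{(2m)!}\sum_{(\sigma,\alpha)}\ \prod_{n\ge1}v_n^{c_n(\sigma)},$$ where the inner sum is over the labelled maps $(\sigma,\alpha)$ with $m$ edges and genus $g$; this is the exponential generating function of labelled maps of genus $g$, with a weight $t$ per edge and, for all $n\ge1$, a weight $v_n$ per vertex of degree $n$. Then all the expectation values defining $\Xi_N(t,V)$ exist, $\Xi_N(t,V)$ has constant term $1$, and $$F_N(t,V)=\sum_{g=0}^{\infty}N^{2-2g}F^{(g)}(t,V)$$ as formal power series in the $v_n$, for every $t>0$. At a given order in $t$, and likewise for a given monomial in the $v_n$, only finitely many $g$ contribute to the sum. Moreover, for a given monomial in the $v_n$ only finitely many powers of $t$ occur in the series $F^{(g)}$, so that the coefficients of both sides are polynomials in $t$. -/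

import Mathlib

open MeasureTheory Equiv

noncomputable section

namespace OneMatrixModel

/-! ### Labelled combinatorial maps -/

section Maps

variable {H : Type*} [Fintype H] [DecidableEq H]

/-- `c(σ)`: the number of cycles of `σ`, fixed points being cycles of length one. -/
def numCycles (σ : Perm H) : ℕ := Multiset.card σ.partition.parts

/-- `c_n(σ)`: the number of cycles of length `n` of `σ` (`n = 1`: fixed points). -/
def numCyclesOfLength (n : ℕ) (σ : Perm H) : ℕ := Multiset.count n σ.partition.parts

/-- A pair of permutations of the set `H` of half-edges is a combinatorial map on `H` when `α` is
an involution without fixed point and the group generated by `σ` and `α` has exactly one orbit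
(it acts transitively, and `H` is not empty). Vertices, edges and faces are the cycles of
`σ`, `α` and `σ ∘ α`. -/
structure IsCombinatorialMap (σ α : Perm H) : Prop where
  nonempty : Nonempty H
  involutive : Function.Involutive α
  fixedPointFree : ∀ h, α h ≠ h
  transitive : MulAction.IsPretransitive (Subgroup.closure {σ, α} : Subgroup (Perm H)) H

/-- The Euler characteristic `#vertices - #edges + #faces`. -/
def eulerChar (σ α : Perm H) : ℤ :=
  (numCycles σ : ℤ) - (numCycles α : ℤ) + (numCycles (σ * α) : ℤ)

/-- The product of the weights `v_n`, one for each vertex of degree `n`, that is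
`∏_{n ≥ 1} v_n ^ c_n(σ)`; the degree of a vertex is between `1` and the number of half-edges. -/
def vertexWeight (σ : Perm H) : MvPolynomial ℕ+ ℚ :=
  ∏ n ∈ Finset.range (Fintype.card H),
    MvPolynomial.X n.succPNat ^ numCyclesOfLength (n + 1) σ

end Maps

open Classical in
/-- The finite set of labelled maps with `m` edges (so `2m` labelled half-edges) and genus `g`. -/
def labelledMaps (g m : ℕ) : Finset (Perm (Fin (2 * m)) × Perm (Fin (2 * m))) :=
  {p | IsCombinatorialMap p.1 p.2 ∧ eulerChar p.1 p.2 = 2 - 2 * (g : ℤ)}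

/-- `F^{(g,m)}(V)`: the sum over labelled maps of genus `g` with `m` edges of the product of
the vertex weights. -/
def mapPolynomial (g m : ℕ) : MvPolynomial ℕ+ ℚ :=
  ∑ p ∈ labelledMaps g m, vertexWeight p.1

/-- The exponential generating function `∑_m t^m / (2m)! F^{(g,m)}(V)` of labelled maps of
genus `g`, as a formal power series in `t` with coefficients in `ℚ[v_1, v_2, …]`. -/
def mapGenFun (g : ℕ) : PowerSeries (MvPolynomial ℕ+ ℚ) :=
  PowerSeries.mk fun m => ((Nat.factorial (2 * m) : ℚ))⁻¹ • mapPolynomial g m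

/-- Substitution of a real number for the formal variable `t`, coefficientwise in the `v_n`:
the coefficient of `v^k` in the result is `∑_m t^m [t^m v^k] F`. It is meaningful when for
each `k` only finitely many `m` contribute. -/
def evalT (t : ℝ) (F : PowerSeries (MvPolynomial ℕ+ ℚ)) : MvPowerSeries ℕ+ ℂ :=
  fun k => ∑ᶠ m : ℕ, (t : ℂ) ^ m * ((MvPolynomial.coeff k (PowerSeries.coeff m F) : ℚ) : ℂ)

/-! ### The Gaussian measure on Hermitian matrices -/

/-- The Hermitian matrix with real coordinates `x`: for `i < j`, `x (i, j)` and `x (j, i)` are the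
real and imaginary parts of the entry `(i, j)`, and `x (i, i)` is the diagonal entry. -/
def hermitianOf {N : ℕ} (x : Fin N × Fin N → ℝ) : Matrix (Fin N) (Fin N) ℂ :=
  Matrix.of fun i j =>
    if i = j then (x (i, i) : ℂ)
    else if i < j then (x (i, j) : ℂ) + (x (j, i) : ℂ) * Complex.I
    else (x (j, i) : ℂ) - (x (i, j) : ℂ) * Complex.I

theorem isHermitian_hermitianOf {N : ℕ} (x : Fin N × Fin N → ℝ) :
    (hermitianOf x).IsHermitian := by
  ext i j
  rcases lt_trichotomy i j with h | h | h
  · simp [hermitianOf, h, h.ne, h.ne', h.not_gt, sub_eq_add_neg]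
  · subst h; simp [hermitianOf]
  · simp [hermitianOf, h, h.ne, h.ne', h.not_gt, sub_eq_add_neg]

/-- Every Hermitian matrix has unique coordinates. -/
theorem existsUnique_hermitianOf {N : ℕ} (M : Matrix (Fin N) (Fin N) ℂ) (hM : M.IsHermitian) :
    ∃! x : Fin N × Fin N → ℝ, hermitianOf x = M := by
  have hc : ∀ i j, star (M j i) = M i j := fun i j => hM.apply i j
  refine ⟨fun p => if p.1 ≤ p.2 then (M p.1 p.2).re else (M p.2 p.1).im, ?_, ?_⟩
  · ext i j
    rcases lt_trichotomy i j with h | h | h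
    · simp [hermitianOf, h, h.ne, h.le, h.not_ge, Complex.re_add_im]
    · subst h
      have := hc i i
      simpa [hermitianOf] using Complex.conj_eq_iff_re.mp this
    · rw [← hc i j]
      simp only [hermitianOf, Matrix.of_apply, h.ne', h.not_gt, h.le, h.not_ge, if_true, if_false]
      apply Complex.ext <;> simp
  · intro y hy
    subst hy
    funext ⟨i, j⟩
    rcases lt_trichotomy i j with h | h | h
    · simp [hermitianOf, h, h.ne, h.le]
    · subst h; simp [hermitianOf]
    · simp [hermitianOf, h, h.ne, h.not_ge]

/-- The unnormalized Gaussian weight `exp (-N Tr M² / (2t))`; the trace is real on Hermitian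
matrices. -/
def gaussianWeight (N : ℕ) (t : ℝ) (M : Matrix (Fin N) (Fin N) ℂ) : ℝ :=
  Real.exp (-(N * (M ^ 2).trace.re) / (2 * t))

/-- The Gaussian probability measure proportional to `exp (-N Tr M² / (2t)) dM` on the space of
Hermitian matrices, in the coordinates of `hermitianOf`, with `dM` the Lebesgue measure. -/
def gaussianMeasure (N : ℕ) (t : ℝ) : Measure (Fin N × Fin N → ℝ) :=
  (∫⁻ x, ENNReal.ofReal (gaussianWeight N t (hermitianOf x)))⁻¹ •
    (volume.withDensity fun x => ENNReal.ofReal (gaussianWeight N t (hermitianOf x)))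

/-- The Gaussian expectation value `⟨f(M)⟩`. -/
def expectation (N : ℕ) (t : ℝ) (f : Matrix (Fin N) (Fin N) ℂ → ℂ) : ℂ :=
  ∫ x, f (hermitianOf x) ∂(gaussianMeasure N t)

/-! ### Partition function and free energy -/

/-- `Tr V(M) = ∑_{n ≥ 1} (v_n / n) Tr M^n`, as a formal power series in the `v_n`. -/
def traceV {N : ℕ} (M : Matrix (Fin N) (Fin N) ℂ) : MvPowerSeries ℕ+ ℂ :=
  fun k => ∑ᶠ n : ℕ+, MvPowerSeries.coeff k (MvPowerSeries.X n : MvPowerSeries ℕ+ ℂ) *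
    ((M ^ (n : ℕ)).trace / (n : ℂ))

/-- The coefficient of `v_n` in `Tr V(M)` is `Tr M^n / n`. -/
theorem coeff_traceV_single {N : ℕ} (M : Matrix (Fin N) (Fin N) ℂ) (n : ℕ+) :
    MvPowerSeries.coeff (Finsupp.single n 1) (traceV M) = (M ^ (n : ℕ)).trace / (n : ℂ) := by
  change (∑ᶠ l : ℕ+, _) = _
  rw [finsum_eq_single _ n]
  · simp
  · intro l hl
    simp [MvPowerSeries.coeff_X, Finsupp.single_left_inj, hl.symm]

/-- `Tr V(M)` has no constant term, so it can be substituted in a power series. -/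
theorem constantCoeff_traceV {N : ℕ} (M : Matrix (Fin N) (Fin N) ℂ) :
    MvPowerSeries.constantCoeff (traceV M) = 0 := by
  rw [← MvPowerSeries.coeff_zero_eq_constantCoeff_apply]
  change (∑ᶠ l : ℕ+, _) = _
  simp

/-- `exp (N Tr V(M))`, as a formal power series in the `v_n`. -/
def expTraceV {N : ℕ} (M : Matrix (Fin N) (Fin N) ℂ) : MvPowerSeries ℕ+ ℂ :=
  (PowerSeries.exp ℂ).subst ((N : ℂ) • traceV M)

/-- The partition function `Ξ_N(t,V) = ⟨exp (N Tr V(M))⟩`: the expectation acts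
coefficientwise. -/
def partitionFunction (N : ℕ) (t : ℝ) : MvPowerSeries ℕ+ ℂ :=
  fun k => expectation N t fun M => MvPowerSeries.coeff k (expTraceV M)

/-- The free energy `F_N(t,V) = log Ξ_N(t,V)`; here `PowerSeries.log` is the series
`log (1 + X)`. -/
def freeEnergy (N : ℕ) (t : ℝ) : MvPowerSeries ℕ+ ℂ :=
  (PowerSeries.log ℂ).subst (partitionFunction N t - 1)

end OneMatrixModel

end

/-! The coefficient of a monomial in `exp (N Tr V(M))` is a constant times a product of traces `Tr
M^n`. If `σ` is a permutation of a set of half-edges with these `n` as cycle lengths, the product is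
the sum, over colourings `i` of the half-edges by `1, …, N`, of `∏ M (i h) (i (σ h))`
(`sum_prod_perm_eq_prod_trace`). Gaussian integration by parts gives Wick's theorem
(`polyExpectation_prod_entryPoly`): the expectation is a sum over pairings `α`, with a factor `t /
N` per pair and the constraint `i h = i (σ (α h))`. The admissible colourings are those constant on
the cycles of `σ * α`, so each `α` counts `N ^ numCycles (σ * α)` (`expectation_prod_trace`).

The factor `N` in front of each trace gives `N ^ numCycles σ`, and each edge carries `N⁻¹`; the
total power of `N` is the Euler characteristic. The factors `1 / n` and `1 / c!` are exactly those
that turn one `σ` into the average over all permutations with its cycle type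
(`card_vertexDegrees_mul_eq`). Hence the partition function is the exponential generating series of
all pairs `(σ, α)`, connected or not (`partitionFunction_eq`).

The logarithm selects the connected pairs. This is proved through the Euler derivation `D = ∑ n v_n
∂/∂v_n`, which multiplies the contribution of a map by its number of half-edges. Marking a half-edge
and cutting out its component gives `exponential_formula`, that is `D C * Ξ = D Ξ` for the connected
series `C`; with the constant terms, this equation characterizes `log Ξ` (`log_subst_eq`,
`freeEnergy_eq`).

Finally, the Euler characteristic of a connected map is `2 - 2g` with `g` a natural number
(`exists_genus`): it is even by comparing signs of permutations, and at most `2` by a rank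
computation over the field with two elements (`numCycles_add_le`). Sorting the connected maps by `g`
gives the expansion (`coeff_connectedMapSeries`). -/

noncomputable section

namespace OneMatrixModel

/-! ### The weight derivation on formal power series -/

/-- The weight `∑ n k_n` of the monomial `∏ v_n ^ k_n`. -/
def wt : (ℕ+ →₀ ℕ) →+ ℕ := Finsupp.weight fun n : ℕ+ => (n : ℕ)

theorem wt_single (n : ℕ+) (c : ℕ) : wt (Finsupp.single n c) = c * n := by
  simp [wt, Finsupp.weight_single]

theorem wt_eq_zero_iff (k : ℕ+ →₀ ℕ) : wt k = 0 ↔ k = 0 := by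
  have : Finsupp.NonTorsionWeight ℕ (fun n : ℕ+ => (n : ℕ)) :=
    Finsupp.nonTorsionWeight_of ℕ _ fun n : ℕ+ => n.ne_zero
  exact Finsupp.weight_eq_zero_iff_eq_zero _

/-- The Euler derivation `∑ n v_n ∂/∂v_n`. -/
def weightDeriv (f : MvPowerSeries ℕ+ ℂ) : MvPowerSeries ℕ+ ℂ :=
  fun k => (wt k : ℂ) * MvPowerSeries.coeff k f

theorem coeff_weightDeriv (f : MvPowerSeries ℕ+ ℂ) (k : ℕ+ →₀ ℕ) :
    MvPowerSeries.coeff k (weightDeriv f) = (wt k : ℂ) * MvPowerSeries.coeff k f := rfl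

theorem weightDeriv_one : weightDeriv 1 = 0 := by
  ext k
  rw [coeff_weightDeriv, MvPowerSeries.coeff_one]
  split_ifs with h <;> simp [h]

theorem weightDeriv_sub (f g : MvPowerSeries ℕ+ ℂ) :
    weightDeriv (f - g) = weightDeriv f - weightDeriv g := by
  ext k
  simp [coeff_weightDeriv, mul_sub]

theorem weightDeriv_mul (f g : MvPowerSeries ℕ+ ℂ) :
    weightDeriv (f * g) = weightDeriv f * g + f * weightDeriv g := by
  ext k
  rw [coeff_weightDeriv, map_add, MvPowerSeries.coeff_mul, MvPowerSeries.coeff_mul,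
    MvPowerSeries.coeff_mul, Finset.mul_sum, ← Finset.sum_add_distrib]
  refine Finset.sum_congr rfl fun p hp => ?_
  rw [← Finset.HasAntidiagonal.mem_antidiagonal.mp hp, coeff_weightDeriv, coeff_weightDeriv, map_add]
  push_cast
  ring

theorem weightDeriv_pow (f : MvPowerSeries ℕ+ ℂ) (d : ℕ) :
    weightDeriv (f ^ d) = (d : ℂ) • (f ^ (d - 1) * weightDeriv f) := by
  induction d with
  | zero => simp [weightDeriv_one]
  | succ d ih =>
    rw [pow_succ, weightDeriv_mul, ih]
    rcases d with _ | d
    · simp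
    · simp only [Nat.add_sub_cancel, Nat.cast_add, Nat.cast_one, add_smul, one_smul, pow_succ,
        MvPowerSeries.smul_eq_C_mul]
      ring

theorem coeff_pow_eq_zero {a : MvPowerSeries ℕ+ ℂ} (ha : MvPowerSeries.constantCoeff a = 0)
    (k : ℕ+ →₀ ℕ) {d : ℕ} (hd : k.degree < d) : MvPowerSeries.coeff k (a ^ d) = 0 :=
  MvPowerSeries.coeff_of_lt_order <|
    lt_of_lt_of_le (by exact_mod_cast hd) (MvPowerSeries.le_order_pow_of_constantCoeff_eq_zero d ha)

/-- Since `a ^ d` has order at least `d`, any bound beyond the degree of `k` will do; the freedom in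
`B` lets several coefficients share one truncation. -/
theorem coeff_subst_eq_sum {a : MvPowerSeries ℕ+ ℂ} (ha : MvPowerSeries.constantCoeff a = 0)
    (f : PowerSeries ℂ) (k : ℕ+ →₀ ℕ) {B : ℕ} (hB : k.degree < B) :
    MvPowerSeries.coeff k (f.subst a) =
      ∑ d ∈ Finset.range B, PowerSeries.coeff d f * MvPowerSeries.coeff k (a ^ d) := by
  rw [PowerSeries.coeff_subst (PowerSeries.HasSubst.of_constantCoeff_zero ha)]
  refine finsum_eq_sum_of_support_subset _ fun d hd => ?_
  by_contra h
  refine hd ?_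
  simp only [Finset.coe_range, Set.mem_Iio, not_lt] at h
  simp [coeff_pow_eq_zero ha k (hB.trans_le h)]

theorem weightDeriv_subst {a : MvPowerSeries ℕ+ ℂ} (ha : MvPowerSeries.constantCoeff a = 0)
    (f : PowerSeries ℂ) :
    weightDeriv (f.subst a) = (PowerSeries.derivative ℂ f).subst a * weightDeriv a := by
  ext k
  -- With `k.degree + 2` terms, removing `d = 0` leaves `k.degree + 1`, the truncation used below
  -- for every `p.1 ≤ k`.
  rw [coeff_weightDeriv, coeff_subst_eq_sum ha f k (B := k.degree + 2) (by omega), Finset.mul_sum,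
    MvPowerSeries.coeff_mul, Finset.sum_range_succ']
  have h0 : (wt k : ℂ) * (PowerSeries.coeff 0 f * MvPowerSeries.coeff k (a ^ 0)) = 0 := by
    have := congrArg (MvPowerSeries.coeff k) weightDeriv_one
    rw [coeff_weightDeriv] at this
    rw [mul_left_comm, pow_zero, this]; simp
  rw [h0, add_zero]
  have h1 : ∀ d, (wt k : ℂ) * (PowerSeries.coeff (d + 1) f * MvPowerSeries.coeff k (a ^ (d + 1))) =
      ∑ p ∈ Finset.HasAntidiagonal.antidiagonal k, PowerSeries.coeff d (PowerSeries.derivative ℂ f) *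
        MvPowerSeries.coeff p.1 (a ^ d) * MvPowerSeries.coeff p.2 (weightDeriv a) := by
    intro d
    rw [mul_left_comm, ← coeff_weightDeriv, weightDeriv_pow, PowerSeries.coeff_derivative]
    simp only [Nat.add_sub_cancel, map_smul, MvPowerSeries.coeff_mul, smul_eq_mul]
    rw [Finset.mul_sum, Finset.mul_sum]
    refine Finset.sum_congr rfl fun p _ => ?_
    push_cast; ring
  rw [Finset.sum_congr rfl fun d _ => h1 d, Finset.sum_comm]
  refine Finset.sum_congr rfl fun p hp => ?_
  rw [coeff_subst_eq_sum ha _ p.1 (B := k.degree + 1), Finset.sum_mul]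
  rw [← Finset.HasAntidiagonal.mem_antidiagonal.mp hp, map_add]
  omega

/-- The derivation is diagonal on monomials, and its eigenvalue `wt k` vanishes only at `k = 0`. -/
theorem eq_zero_of_weightDeriv_eq_zero {f : MvPowerSeries ℕ+ ℂ} (h : weightDeriv f = 0)
    (h0 : MvPowerSeries.constantCoeff f = 0) : f = 0 := by
  ext k
  have := congrArg (MvPowerSeries.coeff k) h
  rw [coeff_weightDeriv, map_zero, mul_eq_zero, Nat.cast_eq_zero, wt_eq_zero_iff] at this
  rcases this with rfl | h
  · simpa using h0
  · simpa using h

/-- The logarithm of a series `Ξ` is the solution of `D C * Ξ = D Ξ` for the Euler derivation `D`. -/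
theorem log_subst_eq {C Ξ : MvPowerSeries ℕ+ ℂ} (h : weightDeriv C * Ξ = weightDeriv Ξ)
    (hC : MvPowerSeries.constantCoeff C = 0) (hΞ : MvPowerSeries.constantCoeff Ξ = 1) :
    (PowerSeries.log ℂ).subst (Ξ - 1) = C := by
  have ha : MvPowerSeries.constantCoeff (Ξ - 1) = 0 := by simp [hΞ]
  have hs : PowerSeries.HasSubst (Ξ - 1) := PowerSeries.HasSubst.of_constantCoeff_zero ha
  -- The derivative of `log (1 + X)` is the inverse of `1 + X`, so its value at `Ξ - 1` is an
  -- inverse of `Ξ`.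
  have hinv : (PowerSeries.derivative ℂ (PowerSeries.log ℂ)).subst (Ξ - 1) * Ξ = 1 := by
    have h1 : PowerSeries.derivative ℂ (PowerSeries.log ℂ) * (1 + PowerSeries.X) = 1 := by
      rw [PowerSeries.deriv_log]
      ext n
      rcases n with _ | n
      · simp [mul_add]
      · simp [mul_add, PowerSeries.coeff_succ_mul_X, PowerSeries.coeff_one, pow_succ]
    have h2 := congrArg (PowerSeries.substAlgHom hs) h1
    rw [map_mul, map_add, map_one, PowerSeries.coe_substAlgHom, PowerSeries.subst_X hs] at h2
    simpa using h2
  have hD : weightDeriv ((PowerSeries.log ℂ).subst (Ξ - 1)) * Ξ = weightDeriv Ξ := by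
    rw [weightDeriv_subst ha, weightDeriv_sub, weightDeriv_one, sub_zero, mul_right_comm, hinv,
      one_mul]
  rw [← sub_eq_zero]
  apply eq_zero_of_weightDeriv_eq_zero
  · have : weightDeriv ((PowerSeries.log ℂ).subst (Ξ - 1) - C) * Ξ = 0 := by
      rw [weightDeriv_sub, sub_mul, hD, h, sub_self]
    have h3 := congrArg (· * (PowerSeries.derivative ℂ (PowerSeries.log ℂ)).subst (Ξ - 1)) this
    simp only [zero_mul] at h3
    rwa [mul_assoc, mul_comm Ξ, hinv, mul_one] at h3
  · rw [map_sub, hC, sub_zero]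
    exact PowerSeries.constantCoeff_subst_eq_zero ha _ PowerSeries.constantCoeff_log

/-- The exponential of a series `a` is the solution of `D F = D a * F` for the Euler derivation `D`. -/
theorem exp_subst_eq {a F : MvPowerSeries ℕ+ ℂ} (h : weightDeriv F = weightDeriv a * F)
    (ha : MvPowerSeries.constantCoeff a = 0) (hF : MvPowerSeries.constantCoeff F = 1) :
    (PowerSeries.exp ℂ).subst a = F := by
  have hE : weightDeriv ((PowerSeries.exp ℂ).subst a) =
      weightDeriv a * (PowerSeries.exp ℂ).subst a := by
    rw [weightDeriv_subst ha, PowerSeries.derivative_exp, mul_comm]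
  have hE0 : MvPowerSeries.coeff 0 ((PowerSeries.exp ℂ).subst a) = 1 := by
    rw [coeff_subst_eq_sum ha _ 0 (B := 1) (by simp)]
    simp
  ext k
  induction hn : wt k using Nat.strong_induction_on generalizing k with
  | _ n ih =>
    by_cases hk : k = 0
    · rw [hk, hE0]; simpa using hF.symm
    · have hw : (wt k : ℂ) ≠ 0 := by exact_mod_cast (wt_eq_zero_iff k).not.mpr hk
      apply mul_left_cancel₀ hw
      rw [← coeff_weightDeriv, ← coeff_weightDeriv, h, hE, MvPowerSeries.coeff_mul,
        MvPowerSeries.coeff_mul]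
      refine Finset.sum_congr rfl fun p hp => ?_
      -- The factor `wt p.1` kills the term with `p.1 = 0`; all others involve coefficients of
      -- strictly smaller weight, which makes the equation a recursion.
      by_cases hp1 : p.1 = 0
      · simp [coeff_weightDeriv, hp1]
      · rw [ih (wt p.2) _ p.2 rfl]
        have := congrArg wt (Finset.HasAntidiagonal.mem_antidiagonal.mp hp)
        rw [map_add] at this
        have := (wt_eq_zero_iff p.1).not.mpr hp1
        omega

theorem coeff_traceV {N : ℕ} (M : Matrix (Fin N) (Fin N) ℂ) (k : ℕ+ →₀ ℕ)
    (hk : ∀ n, k ≠ Finsupp.single n 1) : MvPowerSeries.coeff k (traceV M) = 0 := by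
  change (∑ᶠ l : ℕ+, _) = _
  simp [MvPowerSeries.coeff_X, hk]

/-- The coefficients of `exp (N Tr V(M))`. -/
theorem coeff_expTraceV {N : ℕ} (M : Matrix (Fin N) (Fin N) ℂ) (k : ℕ+ →₀ ℕ) :
    MvPowerSeries.coeff k (expTraceV M) =
      k.prod fun n c => (N * (M ^ (n : ℕ)).trace / n) ^ c / (c.factorial : ℂ) := by
  set F : MvPowerSeries ℕ+ ℂ := fun k =>
    k.prod fun n c => (N * (M ^ (n : ℕ)).trace / n) ^ c / (c.factorial : ℂ) with hF
  have hFc : ∀ k, MvPowerSeries.coeff k F =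
    k.prod fun n c => (N * (M ^ (n : ℕ)).trace / n) ^ c / (c.factorial : ℂ) := fun _ => rfl
  rw [← hFc]
  congr 1
  apply exp_subst_eq
  · ext k
    rw [coeff_weightDeriv, MvPowerSeries.coeff_mul]
    have hinj : Set.InjOn (fun n : ℕ+ => (Finsupp.single n 1, k - Finsupp.single n 1))
        (k.support : Set ℕ+) := by
      intro a _ b _ hab
      simpa [Finsupp.single_left_inj] using congrArg Prod.fst hab
    -- As `Tr V(M)` is linear in the `v_n`, only the splittings that remove one `v_n` from the
    -- monomial contribute.
    rw [← Finset.sum_subset (s₁ := k.support.image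
      fun n : ℕ+ => (Finsupp.single n 1, k - Finsupp.single n 1)), Finset.sum_image hinj]
    · rw [wt, Finsupp.weight_apply, Finsupp.sum, Nat.cast_sum, Finset.sum_mul]
      refine Finset.sum_congr rfl fun n hn => ?_
      have hkn : k n ≠ 0 := Finsupp.mem_support_iff.mp hn
      have hk : k = Finsupp.single n 1 + (k - Finsupp.single n 1) := by
        rw [add_tsub_cancel_of_le]
        simpa using Nat.one_le_iff_ne_zero.mpr hkn
      rw [coeff_weightDeriv, map_smul, coeff_traceV_single, wt_single, hFc, hFc,
        ← Finsupp.mul_prod_erase' k n _ (by simp), ← Finsupp.mul_prod_erase' (k - _) n _ (by simp)]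
      have he : (k - Finsupp.single n 1).erase n = k.erase n := by
        ext i; by_cases hi : i = n <;> simp [hi]
      rw [he]
      obtain ⟨c, hc⟩ := Nat.exists_eq_succ_of_ne_zero hkn
      simp only [Finsupp.coe_tsub, Pi.sub_apply, Finsupp.single_eq_same, hc, Nat.succ_eq_add_one,
        Nat.add_sub_cancel, smul_eq_mul, Nat.factorial_succ]
      have : (n : ℂ) ≠ 0 := by exact_mod_cast n.ne_zero
      have : ((c.factorial : ℕ) : ℂ) ≠ 0 := by exact_mod_cast c.factorial_ne_zero
      have : ((c : ℂ) + 1) ≠ 0 := by exact_mod_cast c.succ_ne_zero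
      generalize (k.erase n).prod (fun n c =>
        (N * (M ^ (n : ℕ)).trace / n) ^ c / (c.factorial : ℂ)) = R
      push_cast
      rw [pow_succ, div_pow, mul_pow]
      field_simp
    · intro p hp
      obtain ⟨n, hn, rfl⟩ := Finset.mem_image.mp hp
      rw [Finset.HasAntidiagonal.mem_antidiagonal, add_tsub_cancel_of_le]
      simpa using Nat.one_le_iff_ne_zero.mpr (Finsupp.mem_support_iff.mp hn)
    · intro p hp hp'
      rw [coeff_weightDeriv, map_smul, coeff_traceV, smul_zero, mul_zero, zero_mul]
      intro n hn
      refine hp' (Finset.mem_image.mpr ⟨n, ?_, ?_⟩)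
      · rw [Finsupp.mem_support_iff, ← Finset.HasAntidiagonal.mem_antidiagonal.mp hp, hn]; simp
      · rw [← Finset.HasAntidiagonal.mem_antidiagonal.mp hp, ← hn]; ext <;> simp
  · simp [constantCoeff_traceV]
  · rw [← MvPowerSeries.coeff_zero_eq_constantCoeff_apply, hFc]; simp

/-! ### Cycle types -/

theorem subtypeCongr_eq_mul {H : Type*} {p : H → Prop} [DecidablePred p] (σ : Perm {x // p x})
    (τ : Perm {x // ¬p x}) : σ.subtypeCongr τ = Perm.ofSubtype σ * Perm.ofSubtype τ := by
  ext x
  by_cases hx : p x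
  · rw [Perm.subtypeCongr.left_apply _ _ hx, Perm.mul_apply,
      Perm.ofSubtype_apply_of_not_mem τ (not_not.mpr hx), Perm.ofSubtype_apply_of_mem σ hx]
  · rw [Perm.subtypeCongr.right_apply _ _ hx, Perm.mul_apply, Perm.ofSubtype_apply_of_mem τ hx,
      Perm.ofSubtype_apply_of_not_mem σ (τ ⟨x, hx⟩).2]

theorem subtypeCongr_subtypePerm {H : Type*} (σ : Perm H) (p : H → Prop) [DecidablePred p]
    (h : ∀ x, p (σ x) ↔ p x) :
    (σ.subtypePerm h).subtypeCongr (σ.subtypePerm (p := fun x => ¬p x) fun x => (h x).not) = σ := by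
  ext x
  rw [Perm.subtypeCongr.apply]
  split_ifs <;> rfl

section CycleTypes

variable {H : Type} [Fintype H] [DecidableEq H]

theorem cycleType_subtypeCongr {p : H → Prop} [DecidablePred p] (σ : Perm {x // p x})
    (τ : Perm {x // ¬p x}) : (σ.subtypeCongr τ).cycleType = σ.cycleType + τ.cycleType := by
  rw [subtypeCongr_eq_mul, Perm.Disjoint.cycleType_mul, Perm.cycleType_ofSubtype,
    Perm.cycleType_ofSubtype]
  intro x
  by_cases hx : p x
  · exact Or.inr (Perm.ofSubtype_apply_of_not_mem τ (not_not.mpr hx))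
  · exact Or.inl (Perm.ofSubtype_apply_of_not_mem σ hx)

theorem parts_subtypeCongr {p : H → Prop} [DecidablePred p] (σ : Perm {x // p x})
    (τ : Perm {x // ¬p x}) :
    (σ.subtypeCongr τ).partition.parts = σ.partition.parts + τ.partition.parts := by
  have hσ := σ.support.card_le_univ
  have hτ := τ.support.card_le_univ
  have hc := Fintype.card_subtype_compl p
  have hc' := Fintype.card_subtype_le p
  rw [Perm.parts_partition, Perm.parts_partition, Perm.parts_partition, cycleType_subtypeCongr,
    add_add_add_comm, ← Multiset.replicate_add, ← Perm.sum_cycleType, cycleType_subtypeCongr,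
    Multiset.sum_add, Perm.sum_cycleType, Perm.sum_cycleType]
  congr 2
  omega

theorem parts_permCongr {H' : Type} [Fintype H'] [DecidableEq H'] (e : H ≃ H') (σ : Perm H) :
    (e.permCongr σ).partition.parts = σ.partition.parts := by
  have h : e.permCongr σ = σ.extendDomain
      (p := fun _ : H' => True) (e.trans (Equiv.subtypeUnivEquiv fun _ => trivial).symm) := by
    ext x
    rw [Perm.extendDomain_apply_subtype _ _ trivial]
    rfl
  rw [Perm.parts_partition, Perm.parts_partition, ← Perm.sum_cycleType, h,
    Perm.cycleType_extendDomain, Perm.sum_cycleType, Fintype.card_congr e]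

theorem parts_finRotate (n : ℕ) : (finRotate (n + 1)).partition.parts = {n + 1} := by
  rcases n with _ | n
  · simp [Perm.parts_partition, finRotate_one, ← Perm.one_def]
  · simp [Perm.parts_partition, cycleType_finRotate]

theorem exists_permCongr_finRotate (σ : Perm H) (a : H) (h : ∀ x, σ.SameCycle a x) :
    ∃ n, ∃ e : Fin (n + 1) ≃ H, e.permCongr (finRotate (n + 1)) = σ := by
  have hpos : 0 < Fintype.card H := Fintype.card_pos_iff.mpr ⟨a⟩
  obtain ⟨n, hn⟩ : ∃ n, Fintype.card H = n + 1 := ⟨Fintype.card H - 1, by omega⟩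
  let e₀ : Fin (n + 1) ≃ H := (Fintype.equivFinOfCardEq hn).symm
  have hparts : σ.partition.parts = {n + 1} := by
    -- A single point is apart: a fixed point is a part of the partition but does not appear in
    -- `cycleType`.
    rcases n with _ | n
    · have : Subsingleton H := Fintype.card_le_one_iff_subsingleton.mp hn.le
      rw [Perm.parts_partition, Subsingleton.elim σ 1]
      simp [hn]
    · have hfix : ∀ x, σ x ≠ x := by
        intro x hx
        have : ∀ y, y = x := by
          intro y
          have hxy : σ.SameCycle x y := (h x).symm.trans (h y)
          exact (hxy.eq_of_left hx).symm
        have := Fintype.card_le_one_iff.mpr fun y z => (this y).trans (this z).symm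
        omega
      have hc : σ.IsCycle := ⟨a, hfix a, fun y _ => h y⟩
      have hs : σ.support = Finset.univ := by ext x; simp [hfix]
      rw [Perm.parts_partition, hc.cycleType, hs, Finset.card_univ, hn]
      simp
  have hconj : IsConj (e₀.permCongr (finRotate (n + 1))) σ := by
    rw [Perm.partition_eq_of_isConj, Nat.Partition.ext_iff, parts_permCongr, parts_finRotate,
      hparts]
  obtain ⟨c, hc⟩ := isConj_iff.mp hconj
  refine ⟨n, e₀.trans c, ?_⟩
  rw [← hc]
  ext x
  simp [Equiv.permCongr_apply, Perm.mul_apply]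

/-- Induction on the cycle decomposition. -/
theorem perm_cycle_induction {P : ∀ (H : Type) [Fintype H] [DecidableEq H], Perm H → Prop}
    (empty : ∀ (H : Type) [Fintype H] [DecidableEq H] [IsEmpty H] (σ : Perm H), P H σ)
    (rotate : ∀ n : ℕ, P (Fin (n + 1)) (finRotate (n + 1)))
    (congr : ∀ (H H' : Type) [Fintype H] [DecidableEq H] [Fintype H'] [DecidableEq H']
      (e : H ≃ H') (σ : Perm H), P H σ → P H' (e.permCongr σ))
    (union : ∀ (H : Type) [Fintype H] [DecidableEq H] (p : H → Prop) [DecidablePred p]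
      (σ : Perm {x // p x}) (τ : Perm {x // ¬p x}), P _ σ → P _ τ → P H (σ.subtypeCongr τ))
    (H : Type) [Fintype H] [DecidableEq H] (σ : Perm H) : P H σ := by
  classical
  induction hn : Fintype.card H using Nat.strong_induction_on generalizing H with
  | _ n ih =>
    rcases isEmpty_or_nonempty H with hH | ⟨⟨a⟩⟩
    · exact empty H σ
    · have hp : ∀ x, σ.SameCycle a (σ x) ↔ σ.SameCycle a x := fun x => Perm.sameCycle_apply_right
      -- Split off the cycle of `a`: it is conjugate to a rotation, and the complement is smaller
      -- because it misses `a`.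
      rw [← subtypeCongr_subtypePerm σ (σ.SameCycle a) hp]
      apply union
      · obtain ⟨n, e, he⟩ := exists_permCongr_finRotate (σ.subtypePerm hp)
          ⟨a, Perm.SameCycle.refl σ a⟩ fun x => by
            obtain ⟨i, hi⟩ := x.2
            exact ⟨i, Subtype.ext (by simpa using hi)⟩
        rw [← he]
        exact congr _ _ e _ (rotate n)
      · refine ih _ ?_ _ _ rfl
        rw [← hn]
        exact Fintype.card_subtype_lt (x := a) (not_not.mpr (Perm.SameCycle.refl σ a))

end CycleTypes

/-! ### Products of traces as sums over colourings -/

section Traces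

variable {ι : Type*} [Fintype ι] [DecidableEq ι] {R : Type*} [CommRing R]

/-- An arbitrary function `F` of the two endpoints makes the induction close: removing the first
vertex `a` absorbs the factor `M a c` into `F`. Taking `F a b = M b a` closes the path into a cycle.
-/
theorem sum_path_eq_pow (M : Matrix ι ι R) (n : ℕ) (F : ι → ι → R) :
    ∑ i : Fin (n + 1) → ι, F (i 0) (i (Fin.last n)) * ∏ h : Fin n, M (i h.castSucc) (i h.succ) =
      ∑ a, ∑ b, F a b * (M ^ n) a b := by
  induction n generalizing F with
  | zero =>
    rw [← (Equiv.funUnique (Fin 1) ι).symm.sum_comp]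
    simp [Matrix.one_apply]
  | succ n ih =>
    rw [← (Fin.consEquiv fun _ : Fin (n + 2) => ι).sum_comp, Fintype.sum_prod_type]
    refine Finset.sum_congr rfl fun a _ => ?_
    have h := ih fun c b => F a b * M a c
    simp only [Fin.consEquiv_apply, Fin.cons_zero, Fin.prod_univ_succ, Fin.castSucc_zero,
      Fin.cons_succ, ← Fin.succ_castSucc, ← Fin.succ_last]
    simp only [← mul_assoc]
    rw [h, Finset.sum_comm]
    refine Finset.sum_congr rfl fun b _ => ?_
    rw [pow_succ', Matrix.mul_apply, Finset.mul_sum]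
    exact Finset.sum_congr rfl fun c _ => by ring

theorem sum_finRotate_eq_trace (M : Matrix ι ι R) (n : ℕ) :
    ∑ i : Fin (n + 1) → ι, ∏ h, M (i h) (i (finRotate (n + 1) h)) = (M ^ (n + 1)).trace := by
  have h := sum_path_eq_pow M n fun a b => M b a
  have hr : ∀ j : Fin n, finRotate (n + 1) j.castSucc = j.succ := fun j => by
    rw [finRotate_apply, Fin.coeSucc_eq_succ]
  simp only [Fin.prod_univ_castSucc, finRotate_last, hr]
  rw [pow_succ, Matrix.trace]
  simp only [mul_comm _ (M (_ : ι) _)]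
  rw [h]
  simp [Matrix.mul_apply, mul_comm]

/-- The sum over the colourings of the half-edges factorizes over the cycles. -/
theorem sum_prod_perm_eq_prod_trace (M : Matrix ι ι R) {H : Type} [Fintype H] [DecidableEq H]
    (σ : Perm H) :
    ∑ i : H → ι, ∏ h, M (i h) (i (σ h)) =
      (σ.partition.parts.map fun n => (M ^ n).trace).prod := by
  revert σ
  refine fun σ => perm_cycle_induction (P := fun H _ _ σ => ∑ i : H → ι, ∏ h, M (i h) (i (σ h)) =
      (σ.partition.parts.map fun n => (M ^ n).trace).prod) ?_ ?_ ?_ ?_ H σ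
  · intro H _ _ _ σ
    rw [Perm.parts_partition, Subsingleton.elim σ 1]
    simp
  · intro n
    rw [sum_finRotate_eq_trace, parts_finRotate]
    simp
  · intro H H' _ _ _ _ e σ h
    rw [parts_permCongr, ← h, ← (Equiv.arrowCongr e (Equiv.refl ι)).sum_comp]
    refine Finset.sum_congr rfl fun i _ => ?_
    rw [← e.prod_comp]
    simp
  · intro H _ _ p _ σ τ hσ hτ
    rw [parts_subtypeCongr, Multiset.map_add, Multiset.prod_add, ← hσ, ← hτ,
      Finset.sum_mul_sum, ← Fintype.sum_prod_type',
      ← (Equiv.piEquivPiSubtypeProd p fun _ => ι).sum_comp]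
    refine Finset.sum_congr rfl fun i _ => ?_
    rw [← Fintype.prod_subtype_mul_prod_subtype p]
    congr 1
    · refine Finset.prod_congr rfl fun x _ => ?_
      rw [Perm.subtypeCongr.left_apply_subtype]; rfl
    · refine Finset.prod_congr rfl fun x _ => ?_
      rw [Perm.subtypeCongr.right_apply_subtype]; rfl

/-- Apply the trace formula to the identity matrix: the product becomes the indicator of colourings
invariant under `σ`, and each cycle contributes the trace of `1`. -/
theorem card_colourings {H : Type} [Fintype H] [DecidableEq H] (σ : Perm H) :
    Fintype.card {f : H → ι // ∀ h, f h = f (σ h)} = Fintype.card ι ^ numCycles σ := by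
  have h := sum_prod_perm_eq_prod_trace (1 : Matrix ι ι ℤ) σ
  simp only [one_pow, Matrix.trace_one, Multiset.map_const', Multiset.prod_replicate,
    Matrix.one_apply, Finset.prod_ite_zero, Finset.prod_const_one] at h
  rw [Finset.sum_boole] at h
  rw [Fintype.card_subtype, numCycles]
  simp only [Finset.mem_univ, true_imp_iff] at h
  exact_mod_cast h

end Traces

/-! ### The genus of a connected map is a natural number -/

/-- The only nonempty set stable under `σ` and `α` is the whole set. -/
def IsConnectedPair {H : Type*} (σ α : Perm H) : Prop :=
  Nonempty H ∧ ∀ T : Set H, T.Nonempty → (∀ x ∈ T, σ x ∈ T) → (∀ x ∈ T, α x ∈ T) → T = Set.univ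

/-- A fixed-point free involution. -/
def IsPairing {H : Type*} (α : Perm H) : Prop := Function.Involutive α ∧ ∀ h, α h ≠ h

theorem apply_mem_iff_of_mapsTo {H : Type*} [Finite H] {σ : Perm H} {T : Set H}
    (h : ∀ x ∈ T, σ x ∈ T) (x : H) : σ x ∈ T ↔ x ∈ T := by
  refine ⟨fun hx => ?_, h x⟩
  have hs : σ '' T = T := Set.eq_of_subset_of_ncard_le (Set.image_subset_iff.mpr h)
    (Set.ncard_image_of_injective T σ.injective).ge
  rw [← hs] at hx
  exact (σ.injective.mem_set_image).mp hx

/-- Orbits are replaced by stable sets, which are easier to cut and transport. Stability under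
inverses is free because `H` is finite. -/
theorem isCombinatorialMap_iff {H : Type*} [Fintype H] [DecidableEq H] {σ α : Perm H} :
    IsCombinatorialMap σ α ↔ IsPairing α ∧ IsConnectedPair σ α := by
  constructor
  · intro h
    refine ⟨⟨h.involutive, h.fixedPointFree⟩, h.nonempty, fun T ⟨x, hx⟩ hσ hα => ?_⟩
    rw [Set.eq_univ_iff_forall]
    intro y
    have := h.transitive
    obtain ⟨⟨g, hg⟩, rfl⟩ :=
      MulAction.exists_smul_eq (Subgroup.closure {σ, α} : Subgroup (Perm H)) x y
    suffices ∀ z, g z ∈ T ↔ z ∈ T from (this x).mpr hx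
    induction hg using Subgroup.closure_induction with
    | mem g hg =>
      rcases hg with rfl | rfl
      · exact apply_mem_iff_of_mapsTo hσ
      · exact apply_mem_iff_of_mapsTo hα
    | one => simp
    | mul a b _ _ ha hb => exact fun z => (ha _).trans (hb z)
    | inv a _ ha => exact fun z => by rw [← ha, ← Perm.mul_apply, mul_inv_cancel, Perm.one_apply]
  · rintro ⟨⟨hi, hf⟩, hne, hT⟩
    refine ⟨hne, hi, hf, ⟨fun x y => ?_⟩⟩
    have h := hT (MulAction.orbit (Subgroup.closure {σ, α} : Subgroup (Perm H)) x)
      ⟨x, MulAction.mem_orbit_self x⟩ ?_ ?_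
    · exact Set.eq_univ_iff_forall.mp h y
    · rintro _ ⟨g, rfl⟩
      exact ⟨⟨σ, Subgroup.subset_closure (by simp)⟩ * g, rfl⟩
    · rintro _ ⟨g, rfl⟩
      exact ⟨⟨α, Subgroup.subset_closure (by simp)⟩ * g, rfl⟩

/-! ### Linear algebra for the genus inequality -/

theorem finrank_map_add_finrank_inf_ker {K V W : Type*} [Field K] [AddCommGroup V] [Module K V]
    [FiniteDimensional K V] [AddCommGroup W] [Module K W] (s : V →ₗ[K] W) (G : Submodule K V) :
    Module.finrank K (G.map s) + Module.finrank K (G ⊓ LinearMap.ker s : Submodule K V) =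
      Module.finrank K G := by
  rw [← LinearMap.finrank_range_add_finrank_ker (s.domRestrict G), LinearMap.range_domRestrict,
    LinearMap.ker_domRestrict, ← Submodule.finrank_map_subtype_eq G, Submodule.map_comap_subtype]

theorem finrank_span_singleton_le {K V : Type*} [Field K] [AddCommGroup V] [Module K V] (v : V) :
    Module.finrank K (Submodule.span K {v}) ≤ 1 := by
  simpa using finrank_span_le_card (R := K) {v}

theorem finrank_submodule_prod {K V W : Type*} [Field K] [AddCommGroup V] [Module K V]
    [AddCommGroup W] [Module K W] [FiniteDimensional K V] [FiniteDimensional K W]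
    (X : Submodule K V) (Y : Submodule K W) :
    Module.finrank K (X.prod Y) = Module.finrank K X + Module.finrank K Y := by
  have h := LinearMap.finrank_range_of_inj (f := X.subtype.prodMap Y.subtype)
    (X.subtype_injective.prodMap Y.subtype_injective)
  rwa [LinearMap.range_prodMap, Submodule.range_subtype, Submodule.range_subtype,
    Module.finrank_prod] at h

/-- `f ↦ f - f ∘ σ`. -/
def coboundary {H : Type} (σ : Perm H) : (H → ZMod 2) →ₗ[ZMod 2] (H → ZMod 2) :=
  LinearMap.id - LinearMap.funLeft (ZMod 2) (ZMod 2) σ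

theorem coboundary_apply {H : Type} (σ : Perm H) (f : H → ZMod 2) (x : H) :
    coboundary σ f x = f x - f (σ x) := rfl

theorem mem_ker_coboundary {H : Type} (σ : Perm H) (f : H → ZMod 2) :
    f ∈ LinearMap.ker (coboundary σ) ↔ ∀ x, f x = f (σ x) := by
  rw [LinearMap.mem_ker, funext_iff]
  exact forall_congr' fun x => by rw [coboundary_apply, Pi.zero_apply, sub_eq_zero]

section Genus

variable {H : Type} [Fintype H] [DecidableEq H]

/-- The kernel consists of the `σ`-invariant colourings by two colours, so its cardinality is a
power of two computed in two ways. -/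
theorem finrank_ker_coboundary (σ : Perm H) :
    Module.finrank (ZMod 2) (LinearMap.ker (coboundary σ)) = numCycles σ := by
  classical
  have h1 := card_colourings (ι := ZMod 2) σ
  have h2 := Module.card_eq_pow_finrank (K := ZMod 2) (V := LinearMap.ker (coboundary σ))
  have h3 : Fintype.card {f : H → ZMod 2 // ∀ h, f h = f (σ h)} =
      Fintype.card (LinearMap.ker (coboundary σ)) :=
    Fintype.card_congr (Equiv.subtypeEquivRight fun f => (mem_ker_coboundary σ f).symm)
  rw [h2, h1, ZMod.card] at h3
  exact (Nat.pow_right_injective le_rfl h3).symm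

theorem finrank_range_coboundary (σ : Perm H) :
    Module.finrank (ZMod 2) (LinearMap.range (coboundary σ)) + numCycles σ = Fintype.card H := by
  rw [← finrank_ker_coboundary, LinearMap.finrank_range_add_finrank_ker, Module.finrank_pi]

/-- The two ranges span every difference of basis vectors: the `b` for which `δ_b - δ_a` is reached
form a set containing `a` and stable under `σ` and `α`. Adding `δ_a` itself then gives the whole
space. -/
theorem card_le_finrank_sup_range {σ α : Perm H} (h : IsConnectedPair σ α) :
    Fintype.card H ≤ Module.finrank (ZMod 2)
      (LinearMap.range (coboundary α) ⊔ LinearMap.range (coboundary σ) :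
        Submodule (ZMod 2) (H → ZMod 2)) + 1 := by
  set W : Submodule (ZMod 2) (H → ZMod 2) :=
    LinearMap.range (coboundary α) ⊔ LinearMap.range (coboundary σ) with hW
  obtain ⟨⟨a⟩, hT⟩ := h
  have hd : ∀ τ : Perm H, ∀ x, coboundary τ (Pi.single (τ x) 1) =
      Pi.single (τ x) 1 - Pi.single x 1 := by
    intro τ x
    ext y
    simp [coboundary_apply, Pi.single_apply]
  have hmem : ∀ b, (Pi.single b 1 - Pi.single a 1 : H → ZMod 2) ∈ W := by
    have hu := hT {b | (Pi.single b 1 - Pi.single a 1 : H → ZMod 2) ∈ W} ⟨a, by simp⟩ ?_ ?_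
    · intro b
      have hb : b ∈ {b | (Pi.single b 1 - Pi.single a 1 : H → ZMod 2) ∈ W} := hu ▸ Set.mem_univ b
      exact hb
    · intro x hx
      have h1 : coboundary σ (Pi.single (σ x) 1) ∈ W :=
        Submodule.mem_sup_right ⟨_, rfl⟩
      rw [hd] at h1
      simpa using W.add_mem h1 hx
    · intro x hx
      have h1 : coboundary α (Pi.single (α x) 1) ∈ W :=
        Submodule.mem_sup_left ⟨_, rfl⟩
      rw [hd] at h1
      simpa using W.add_mem h1 hx
  have htop : W ⊔ Submodule.span (ZMod 2) {(Pi.single a 1 : H → ZMod 2)} = ⊤ := by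
    rw [eq_top_iff, ← (Pi.basisFun (ZMod 2) H).span_eq, Submodule.span_le]
    rintro _ ⟨b, rfl⟩
    rw [Pi.basisFun_apply, SetLike.mem_coe,
      ← sub_add_cancel (Pi.single b 1 : H → ZMod 2) (Pi.single a 1)]
    exact Submodule.add_mem_sup (hmem b) (Submodule.mem_span_singleton_self _)
  have h1 := Submodule.finrank_add_le_finrank_add_finrank W
    (Submodule.span (ZMod 2) {(Pi.single a 1 : H → ZMod 2)})
  rw [htop, finrank_top, Module.finrank_pi] at h1
  exact h1.trans (Nat.add_le_add_left (finrank_span_singleton_le _) _)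

/-- The genus inequality. -/
theorem numCycles_add_le {σ α : Perm H} (h : IsConnectedPair σ α) :
    numCycles σ + numCycles α + numCycles (σ * α) ≤ Fintype.card H + 2 := by
  -- Write `n` for the number of half-edges. The map `c = (∂α, ∂σ)` lands in `X × Y`, and `s (u, v)
  -- = u + v ∘ α` satisfies `s ∘ c = ∂(σα)`. Hence `range c ⊓ ker s` lies in `(X × Y) ⊓ ker s`.
  -- Connectedness makes `ker c` consist of constants, so the first space has dimension at least
  -- `numCycles (σ * α) - 1`; it also makes `s (X × Y)` of codimension at most one, so the second
  -- has dimension at most `n + 1 - numCycles σ - numCycles α`.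
  set X := LinearMap.range (coboundary α) with hX
  set Y := LinearMap.range (coboundary σ) with hY
  set B := LinearMap.funLeft (ZMod 2) (ZMod 2) α with hB
  set s : (H → ZMod 2) × (H → ZMod 2) →ₗ[ZMod 2] (H → ZMod 2) :=
    LinearMap.id.coprod B with hs
  set c := (coboundary α).prod (coboundary σ) with hc
  have hcomp : s ∘ₗ c = coboundary (σ * α) := by
    refine LinearMap.ext fun f => funext fun x => ?_
    change f x - f (α x) + (f (α x) - f (σ (α x))) = f x - f (σ (α x))
    ring
  have hker : Module.finrank (ZMod 2) (LinearMap.ker c) ≤ 1 := by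
    obtain ⟨⟨a⟩, hT⟩ := h
    have hle : LinearMap.ker c ≤ Submodule.span (ZMod 2) {(fun _ => 1 : H → ZMod 2)} := by
      intro f hf
      rw [hc, LinearMap.ker_prod, Submodule.mem_inf, mem_ker_coboundary, mem_ker_coboundary] at hf
      rw [Submodule.mem_span_singleton]
      refine ⟨f a, funext fun x => ?_⟩
      have := Set.eq_univ_iff_forall.mp (hT {x | f x = f a} ⟨a, rfl⟩
        (fun x hx => (hf.2 x).symm.trans hx) fun x hx => (hf.1 x).symm.trans hx) x
      simpa using this.symm
    exact (Submodule.finrank_mono hle).trans (finrank_span_singleton_le _)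
  have hrc := LinearMap.finrank_range_add_finrank_ker c
  rw [Module.finrank_pi] at hrc
  have h1 := finrank_map_add_finrank_inf_ker s (LinearMap.range c)
  have h2 := finrank_map_add_finrank_inf_ker s (X.prod Y)
  have h3 : Module.finrank (ZMod 2) (LinearMap.range c ⊓ LinearMap.ker s : Submodule _ _) ≤
      Module.finrank (ZMod 2) (X.prod Y ⊓ LinearMap.ker s : Submodule _ _) := by
    refine Submodule.finrank_mono (inf_le_inf_right _ ?_)
    rintro _ ⟨f, rfl⟩
    exact ⟨⟨f, rfl⟩, ⟨f, rfl⟩⟩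
  rw [← LinearMap.range_comp, hcomp] at h1
  have h4 : Module.finrank (ZMod 2) (X.prod Y) =
      Module.finrank (ZMod 2) X + Module.finrank (ZMod 2) Y := by
    exact finrank_submodule_prod X Y
  have h5 : Fintype.card H ≤ Module.finrank (ZMod 2) ((X.prod Y).map s) + 1 := by
    refine (card_le_finrank_sup_range h).trans (Nat.add_le_add_right ?_ 1)
    have hinj : Function.Injective B := LinearMap.funLeft_injective_of_surjective _ _ _ α.surjective
    have h6 := finrank_map_add_finrank_inf_ker B (X ⊔ Y)
    rw [LinearMap.ker_eq_bot.mpr hinj, inf_bot_eq, finrank_bot, add_zero] at h6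
    rw [← h6, Submodule.map_sup]
    refine Submodule.finrank_mono (sup_le ?_ ?_)
    · rintro _ ⟨_, ⟨f, rfl⟩, rfl⟩
      exact ⟨(coboundary α (B f), 0), ⟨⟨B f, rfl⟩, Y.zero_mem⟩, by
        rw [hs, LinearMap.coprod_apply, map_zero, add_zero]; rfl⟩
    · rintro _ ⟨f, hf, rfl⟩
      exact ⟨(0, f), ⟨X.zero_mem, hf⟩, by simp [hs]⟩
  rw [h4] at h2
  have e1 := finrank_range_coboundary σ
  have e2 := finrank_range_coboundary α
  have e3 := finrank_range_coboundary (σ * α)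
  rw [← hX] at e2
  rw [← hY] at e1
  omega

theorem sign_eq_neg_one_pow (σ : Perm H) :
    Perm.sign σ = (-1) ^ (Fintype.card H + numCycles σ) := by
  have h := σ.support.card_le_univ
  rw [Perm.sign_of_cycleType, Perm.sum_cycleType, numCycles, Perm.parts_partition,
    Multiset.card_add, Multiset.card_replicate]
  have : Fintype.card H + (Multiset.card σ.cycleType + (Fintype.card H - σ.support.card)) =
    σ.support.card + Multiset.card σ.cycleType + 2 * (Fintype.card H - σ.support.card) := by
    omega
  rw [this, pow_add _ _ (2 * _), pow_mul]
  simp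

theorem IsPairing.two_mul_numCycles {α : Perm H} (h : IsPairing α) :
    2 * numCycles α = Fintype.card H := by
  have hs : α.support = Finset.univ := by ext x; simp [h.2]
  have h2 : α ^ 2 = 1 := by ext x; simp [pow_two, h.1 x]
  have hc := Perm.cycleType_of_pow_prime_eq_one (p := 2) h2
  have := Perm.sum_cycleType α
  rw [hc, hs, Finset.card_univ, Multiset.sum_replicate] at this
  rw [numCycles, Perm.parts_partition, hs, Finset.card_univ]
  simp at this ⊢
  omega

theorem exists_genus {σ α : Perm H} (hα : IsPairing α) (h : IsConnectedPair σ α) :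
    ∃ g : ℕ, eulerChar σ α = 2 - 2 * (g : ℤ) := by
  have h1 := numCycles_add_le h
  have h2 := hα.two_mul_numCycles
  -- Parity comes from multiplicativity of the sign, which is `(-1)` to the number of points plus
  -- the number of cycles.
  have h3 : Even (numCycles σ + numCycles (σ * α) + numCycles α) := by
    have h4 := Perm.sign_mul σ α
    rw [sign_eq_neg_one_pow, sign_eq_neg_one_pow, sign_eq_neg_one_pow, ← pow_add, ← h2] at h4
    have h5 : Even (2 * numCycles α + numCycles (σ * α)) ↔
        Even (2 * numCycles α + numCycles σ + (2 * numCycles α + numCycles α)) := by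
      rw [← neg_one_pow_eq_one_iff_even (R := ℤˣ) (by decide), h4,
        neg_one_pow_eq_one_iff_even (by decide)]
    rw [Nat.even_iff, Nat.even_iff] at h5
    rw [Nat.even_iff]
    omega
  obtain ⟨r, hr⟩ := h3
  -- With `2 r` the total number of cycles, the Euler characteristic is `2 r - 2 numCycles α`; the
  -- genus inequality ensures that the subtraction is not truncated.
  refine ⟨numCycles α + 1 - r, ?_⟩
  rw [eulerChar]
  omega

end Genus

/-! ### Gaussian integrals of polynomials -/

theorem integrable_pow_mul_exp_neg_mul_sq {b : ℝ} (hb : 0 < b) (k : ℕ) :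
    Integrable fun x : ℝ => x ^ k * Real.exp (-b * x ^ 2) := by
  simpa using integrable_rpow_mul_exp_neg_mul_sq hb (s := k) (by linarith [k.cast_nonneg (α := ℝ)])

/-- The unnormalized moments of a centred Gaussian. -/
def gaussianMoment (b : ℝ) (k : ℕ) : ℝ := ∫ x : ℝ, x ^ k * Real.exp (-b * x ^ 2)

theorem gaussianMoment_zero_pos {b : ℝ} (hb : 0 < b) : 0 < gaussianMoment b 0 := by
  simp only [gaussianMoment, pow_zero, one_mul]
  rw [integral_gaussian]
  exact Real.sqrt_pos.mpr (div_pos Real.pi_pos hb)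

/-- The derivative of `x ^ k * exp (-b x²)` has integral zero. For `k = 0` the truncated exponent `k
- 1` is harmless because of the factor `k`. -/
theorem gaussianMoment_succ {b : ℝ} (hb : 0 < b) (k : ℕ) :
    gaussianMoment b (k + 1) = (2 * b)⁻¹ * (k * gaussianMoment b (k - 1)) := by
  have hd : ∀ x : ℝ, HasDerivAt (fun x : ℝ => x ^ k * Real.exp (-b * x ^ 2))
      (k * (x ^ (k - 1) * Real.exp (-b * x ^ 2)) -
        2 * b * (x ^ (k + 1) * Real.exp (-b * x ^ 2))) x := by
    intro x
    have h1 := (hasDerivAt_pow k x).mul (((hasDerivAt_pow 2 x).const_mul (-b)).exp)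
    convert! h1 using 1
    push_cast
    ring
  have hi := integrable_pow_mul_exp_neg_mul_sq hb
  have h := integral_eq_zero_of_hasDerivAt_of_integrable hd
    (((hi (k - 1)).const_mul _).sub ((hi (k + 1)).const_mul _)) (hi k)
  rw [integral_sub ((hi (k - 1)).const_mul _) ((hi (k + 1)).const_mul _),
    integral_const_mul, integral_const_mul] at h
  change k * gaussianMoment b (k - 1) - 2 * b * gaussianMoment b (k + 1) = 0 at h
  rw [eq_inv_mul_iff_mul_eq₀ (by positivity)]
  linarith

section Pi

variable {ι : Type*} [Fintype ι]

/-- The density `exp (-∑ b_p x_p²)`. -/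
def piWeight (b : ι → ℝ) (x : ι → ℝ) : ℝ := ∏ p, Real.exp (-b p * x p ^ 2)

theorem piWeight_pos (b : ι → ℝ) (x : ι → ℝ) : 0 < piWeight b x :=
  Finset.prod_pos fun _ _ => Real.exp_pos _

theorem continuous_piWeight (b : ι → ℝ) : Continuous (piWeight b) := by
  unfold piWeight
  fun_prop

/-- The normalized Gaussian measure with density proportional to `exp (-∑ b_p x_p²)`. -/
def piGaussian (b : ι → ℝ) : Measure (ι → ℝ) :=
  (∫⁻ x, ENNReal.ofReal (piWeight b x))⁻¹ •
    (volume.withDensity fun x => ENNReal.ofReal (piWeight b x))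

theorem piWeight_mul_monomial (b : ι → ℝ) (k : ι →₀ ℕ) (a : ℂ) (x : ι → ℝ) :
    (piWeight b x : ℂ) * MvPolynomial.eval (fun p => (x p : ℂ)) (MvPolynomial.monomial k a) =
      a * ((∏ p, (x p ^ k p * Real.exp (-b p * x p ^ 2)) : ℝ) : ℂ) := by
  rw [MvPolynomial.eval_monomial, Finsupp.prod_fintype _ _ (by simp), Finset.prod_mul_distrib,
    piWeight]
  push_cast
  ring

variable {b : ι → ℝ}

theorem integrable_piWeight_mul_monomial (hb : ∀ p, 0 < b p) (k : ι →₀ ℕ) (a : ℂ) :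
    Integrable fun x : ι → ℝ => (piWeight b x : ℂ) *
      MvPolynomial.eval (fun p => (x p : ℂ)) (MvPolynomial.monomial k a) := by
  simp only [piWeight_mul_monomial]
  refine Integrable.const_mul (Integrable.ofReal ?_) a
  exact Integrable.fintype_prod (μ := fun _ => volume)
    (f := fun p (y : ℝ) => y ^ k p * Real.exp (-b p * y ^ 2))
    fun p => integrable_pow_mul_exp_neg_mul_sq (hb p) (k p)

theorem integral_piWeight_mul_monomial (b : ι → ℝ) (k : ι →₀ ℕ) (a : ℂ) :
    ∫ x : ι → ℝ, (piWeight b x : ℂ) *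
      MvPolynomial.eval (fun p => (x p : ℂ)) (MvPolynomial.monomial k a) =
      a * ∏ p, (gaussianMoment (b p) (k p) : ℂ) := by
  simp only [piWeight_mul_monomial]
  rw [integral_const_mul, integral_complex_ofReal,
    integral_fintype_prod_volume_eq_prod (f := fun p (y : ℝ) => y ^ k p * Real.exp (-b p * y ^ 2))]
  push_cast
  rfl

theorem integral_piWeight_pos (hb : ∀ p, 0 < b p) : 0 < ∫ x, piWeight b x := by
  have h := integral_piWeight_mul_monomial b 0 1
  simp only [MvPolynomial.monomial_zero', map_one, mul_one, one_mul,
    integral_complex_ofReal] at h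
  have h' : ∫ x, piWeight b x = ∏ p, gaussianMoment (b p) 0 := by exact_mod_cast h
  rw [h']
  exact Finset.prod_pos fun p _ => gaussianMoment_zero_pos (hb p)

theorem integrable_piWeight (hb : ∀ p, 0 < b p) : Integrable (piWeight b) := by
  by_contra h
  -- A non-integrable function would have integral `0` by convention.
  exact (integral_piWeight_pos hb).ne' (integral_undef h)

theorem lintegral_piWeight (hb : ∀ p, 0 < b p) :
    ∫⁻ x, ENNReal.ofReal (piWeight b x) = ENNReal.ofReal (∫ x, piWeight b x) :=
  (ofReal_integral_eq_lintegral_ofReal (integrable_piWeight hb)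
    (Filter.Eventually.of_forall fun x => (piWeight_pos b x).le)).symm

theorem isProbabilityMeasure_piGaussian (hb : ∀ p, 0 < b p) :
    IsProbabilityMeasure (piGaussian b) := by
  refine ⟨?_⟩
  rw [piGaussian, Measure.smul_apply, withDensity_apply _ MeasurableSet.univ, setLIntegral_univ,
    smul_eq_mul, lintegral_piWeight hb]
  exact ENNReal.inv_mul_cancel (by simpa using integral_piWeight_pos hb) ENNReal.ofReal_ne_top

theorem integrable_piGaussian (hb : ∀ p, 0 < b p) (f : (ι → ℝ) → ℂ)
    (h : Integrable fun x => (piWeight b x : ℂ) * f x) : Integrable f (piGaussian b) := by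
  refine Integrable.smul_measure ?_ ?_
  · rw [integrable_withDensity_iff_integrable_smul' (by
      exact (continuous_piWeight b).measurable.ennreal_ofReal) (by simp)]
    convert! h using 2 with x
    rw [ENNReal.toReal_ofReal (piWeight_pos b x).le, Complex.real_smul]
  · rw [lintegral_piWeight hb]
    simpa using integral_piWeight_pos hb

theorem integral_piGaussian (hb : ∀ p, 0 < b p) (f : (ι → ℝ) → ℂ) :
    ∫ x, f x ∂(piGaussian b) =
      ((∫ x, piWeight b x : ℝ) : ℂ)⁻¹ * ∫ x, (piWeight b x : ℂ) * f x := by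
  rw [piGaussian, integral_smul_measure, integral_withDensity_eq_integral_toReal_smul
    (by exact (continuous_piWeight b).measurable.ennreal_ofReal) (by simp), lintegral_piWeight hb,
    ENNReal.toReal_inv, ENNReal.toReal_ofReal (integral_piWeight_pos hb).le, Complex.real_smul]
  simp only [ENNReal.toReal_ofReal (piWeight_pos b _).le, Complex.real_smul, Complex.ofReal_inv]

theorem integrable_eval_piGaussian (hb : ∀ p, 0 < b p) (P : MvPolynomial ι ℂ) :
    Integrable (fun x : ι → ℝ => MvPolynomial.eval (fun p => (x p : ℂ)) P) (piGaussian b) := by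
  induction P using MvPolynomial.induction_on' with
  | monomial k a => exact integrable_piGaussian hb _ (integrable_piWeight_mul_monomial hb k a)
  | add P Q hP hQ =>
    simp only [map_add]
    exact hP.add hQ

/-- Gaussian expectation of polynomials. -/
def polyExpectation (hb : ∀ p, 0 < b p) : MvPolynomial ι ℂ →ₗ[ℂ] ℂ where
  toFun P := ∫ x, MvPolynomial.eval (fun p => (x p : ℂ)) P ∂(piGaussian b)
  map_add' P Q := by
    simp only [map_add]
    exact integral_add (integrable_eval_piGaussian hb P) (integrable_eval_piGaussian hb Q)
  map_smul' c P := by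
    simp only [MvPolynomial.smul_eval, integral_const_mul, RingHom.id_apply, smul_eq_mul]

theorem polyExpectation_one (hb : ∀ p, 0 < b p) : polyExpectation hb 1 = 1 := by
  have := isProbabilityMeasure_piGaussian hb
  simp [polyExpectation]

theorem polyExpectation_monomial (hb : ∀ p, 0 < b p) (k : ι →₀ ℕ) (a : ℂ) :
    polyExpectation hb (MvPolynomial.monomial k a) =
      ((∫ x, piWeight b x : ℝ) : ℂ)⁻¹ * (a * ∏ p, (gaussianMoment (b p) (k p) : ℂ)) := by
  rw [← integral_piWeight_mul_monomial, ← integral_piGaussian hb]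
  rfl

/-- Gaussian integration by parts. -/
theorem polyExpectation_X_mul (hb : ∀ p, 0 < b p) (p : ι) (P : MvPolynomial ι ℂ) :
    polyExpectation hb (MvPolynomial.X p * P) =
      ((2 * b p : ℝ) : ℂ)⁻¹ * polyExpectation hb (MvPolynomial.pderiv p P) := by
  classical
  induction P using MvPolynomial.induction_on' with
  | add P Q hP hQ => rw [mul_add, map_add, hP, hQ, map_add, map_add, mul_add]
  | monomial k a =>
    rw [MvPolynomial.pderiv_monomial, MvPolynomial.X, MvPolynomial.monomial_mul,
      polyExpectation_monomial, polyExpectation_monomial, ← Finset.mul_prod_erase _ _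
      (Finset.mem_univ p), ← Finset.mul_prod_erase _ (fun q => (gaussianMoment (b q)
      ((k - Finsupp.single p 1 : ι →₀ ℕ) q) : ℂ)) (Finset.mem_univ p)]
    -- The moments factor over the coordinates; only the one at `p` changes, and there the
    -- one-dimensional recursion applies.
    have hq : ∏ q ∈ Finset.univ.erase p,
        (gaussianMoment (b q) ((Finsupp.single p 1 + k : ι →₀ ℕ) q) : ℂ) = ∏ q ∈ Finset.univ.erase p,
          (gaussianMoment (b q) ((k - Finsupp.single p 1 : ι →₀ ℕ) q) : ℂ) := by
      refine Finset.prod_congr rfl fun q hq => ?_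
      have : p ≠ q := (Finset.ne_of_mem_erase hq).symm
      simp [this]
    have hp : (Finsupp.single p 1 + k : ι →₀ ℕ) p = k p + 1 := by simp [add_comm]
    rw [hq, hp, gaussianMoment_succ (hb p)]
    simp only [Finsupp.coe_tsub, Pi.sub_apply, Finsupp.single_eq_same]
    push_cast
    ring

end Pi

theorem derivation_finset_prod {R A : Type*} [CommRing R] [CommRing A] [Algebra R A]
    (D : Derivation R A A) {H : Type*} [DecidableEq H] (S : Finset H) (f : H → A) :
    D (∏ h ∈ S, f h) = ∑ b ∈ S, D (f b) * ∏ h ∈ S.erase b, f h := by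
  induction S using Finset.induction_on with
  | empty => simp
  | insert a S ha ih =>
    rw [Finset.prod_insert ha, Derivation.leibniz, ih, Finset.sum_insert ha,
      Finset.erase_insert ha, smul_eq_mul, smul_eq_mul, Finset.mul_sum, add_comm, mul_comm]
    congr 1
    refine Finset.sum_congr rfl fun b hb => ?_
    have hab : a ≠ b := fun h => ha (h ▸ hb)
    rw [Finset.erase_insert_of_ne hab, Finset.prod_insert (by simp [ha])]
    ring

/-! ### The Gaussian measure on Hermitian matrices -/

section Matrix

variable {N : ℕ}

/-- The inverse variances of the real coordinates, up to a factor two. -/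
def coordRate (N : ℕ) (t : ℝ) (p : Fin N × Fin N) : ℝ :=
  (if p.1 = p.2 then 1 else 2) * (N / (2 * t))

theorem coordRate_pos (hN : 1 ≤ N) {t : ℝ} (ht : 0 < t) (p : Fin N × Fin N) :
    0 < coordRate N t p := by
  have : (0 : ℝ) < N := by exact_mod_cast hN
  rw [coordRate]
  split_ifs <;> positivity

theorem trace_sq_re (x : Fin N × Fin N → ℝ) :
    (hermitianOf x ^ 2).trace.re = ∑ p : Fin N × Fin N, (if p.1 = p.2 then 1 else 2) * x p ^ 2 := by
  set f : Fin N → Fin N → ℝ := fun i j => (if i = j then 1 else 2) * x (i, j) ^ 2 with hf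
  -- Off the diagonal `M_ij M_ji = x_ij² + x_ji²`; writing it as an average of `f i j` and `f j i`
  -- makes the double sum symmetric.
  have h : ∀ i j, (hermitianOf x i j * hermitianOf x j i).re = (f i j + f j i) / 2 := by
    intro i j
    rcases lt_trichotomy i j with h | h | h
    · simp [hermitianOf, hf, h.ne, h.ne', h, h.not_gt]; ring
    · subst h; simp [hermitianOf, hf]; ring
    · simp [hermitianOf, hf, h.ne, h.ne', h, h.not_gt]; ring
  rw [pow_two, Matrix.trace]
  simp only [Matrix.diag_apply, Matrix.mul_apply, Complex.re_sum, h]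
  rw [Fintype.sum_prod_type]
  simp only [← Finset.sum_div, Finset.sum_add_distrib]
  rw [Finset.sum_comm (f := fun i j => f j i)]
  ring

theorem gaussianMeasure_eq (N : ℕ) (t : ℝ) :
    gaussianMeasure N t = piGaussian (coordRate N t) := by
  have h : ∀ x : Fin N × Fin N → ℝ,
      gaussianWeight N t (hermitianOf x) = piWeight (coordRate N t) x := by
    intro x
    rw [gaussianWeight, piWeight, ← Real.exp_sum, trace_sq_re]
    congr 1
    rw [Finset.mul_sum, neg_div, Finset.sum_div, ← Finset.sum_neg_distrib]
    refine Finset.sum_congr rfl fun p _ => ?_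
    rw [coordRate]
    ring
  simp only [gaussianMeasure, piGaussian, h]

/-- The entries of a Hermitian matrix as polynomials in its real coordinates. -/
def entryPoly (i j : Fin N) : MvPolynomial (Fin N × Fin N) ℂ :=
  if i = j then MvPolynomial.X (i, i)
  else if i < j then MvPolynomial.X (i, j) + Complex.I • MvPolynomial.X (j, i)
  else MvPolynomial.X (j, i) - Complex.I • MvPolynomial.X (i, j)

theorem eval_entryPoly (x : Fin N × Fin N → ℝ) (i j : Fin N) :
    MvPolynomial.eval (fun p => (x p : ℂ)) (entryPoly i j) = hermitianOf x i j := by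
  rw [entryPoly, hermitianOf, Matrix.of_apply]
  split_ifs <;> simp [mul_comm]

/-- The derivation along the conjugate of the entry `(i, j)`. -/
def entryDeriv (i j : Fin N) :
    Derivation ℂ (MvPolynomial (Fin N × Fin N) ℂ) (MvPolynomial (Fin N × Fin N) ℂ) :=
  if i = j then MvPolynomial.pderiv (i, i)
  else if i < j then
    (2 : ℂ)⁻¹ • (MvPolynomial.pderiv (i, j) + Complex.I • MvPolynomial.pderiv (j, i))
  else (2 : ℂ)⁻¹ • (MvPolynomial.pderiv (j, i) - Complex.I • MvPolynomial.pderiv (i, j))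

/-- Thus `entryDeriv i j` acts as `∂/∂M_ji`, and the index pattern is that of the propagator `⟨M_ij
M_kl⟩`. -/
theorem entryDeriv_entryPoly (i j k l : Fin N) :
    entryDeriv i j (entryPoly k l) = if i = l ∧ j = k then 1 else 0 := by
  have hX : ∀ p q : Fin N × Fin N, MvPolynomial.pderiv p (MvPolynomial.X q) =
      if q.1 = p.1 ∧ q.2 = p.2 then (1 : MvPolynomial (Fin N × Fin N) ℂ) else 0 := by
    intro p q
    simp only [MvPolynomial.pderiv_X, Pi.single_apply, Prod.ext_iff]
  have hI : Complex.I * Complex.I = -1 := Complex.I_mul_I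
  rw [entryDeriv, entryPoly]
  split_ifs with h1 h2 h3 h4 h5 h6 h7 h8 h9 <;>
    simp only [Derivation.smul_apply, Derivation.add_apply, Derivation.sub_apply,
      map_add, map_sub, Derivation.map_smul, hX]
  all_goals
    split_ifs <;>
    first
    | (exfalso; omega)
    | module
    | (match_scalars; linear_combination (1 / 2) * hI)
    | (match_scalars; linear_combination (-1 / 2) * hI)

/-- Off-diagonal coordinates have half the variance of diagonal ones; the factor `1/2` in
`entryDeriv` accounts for this, so the constant is `t / N` for every entry. -/
theorem polyExpectation_entryPoly_mul (hN : 1 ≤ N) {t : ℝ} (ht : 0 < t) (i j : Fin N)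
    (P : MvPolynomial (Fin N × Fin N) ℂ) :
    polyExpectation (coordRate_pos hN ht) (entryPoly i j * P) =
      ((t / N : ℝ) : ℂ) * polyExpectation (coordRate_pos hN ht) (entryDeriv i j P) := by
  have hN' : (N : ℂ) ≠ 0 := by exact_mod_cast (by omega : N ≠ 0)
  have ht' : (t : ℂ) ≠ 0 := by exact_mod_cast ht.ne'
  have hd : ((2 * coordRate N t (i, i) : ℝ) : ℂ)⁻¹ = ((t / N : ℝ) : ℂ) := by
    simp only [coordRate, if_true]
    push_cast
    field_simp
  have ho : ∀ {a b : Fin N}, a ≠ b →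
      ((2 * coordRate N t (a, b) : ℝ) : ℂ)⁻¹ = ((t / N : ℝ) : ℂ) * (2 : ℂ)⁻¹ := by
    intro a b hab
    simp only [coordRate, hab, if_false]
    push_cast
    field_simp
  rw [entryPoly, entryDeriv]
  split_ifs with h1 h2
  · rw [polyExpectation_X_mul, hd]
  · rw [add_mul, smul_mul_assoc, map_add, map_smul, polyExpectation_X_mul, polyExpectation_X_mul,
      ho h1, ho (Ne.symm h1)]
    simp only [Derivation.smul_apply, Derivation.add_apply, map_smul, map_add, smul_eq_mul]
    ring
  · rw [sub_mul, smul_mul_assoc, map_sub, map_smul, polyExpectation_X_mul, polyExpectation_X_mul,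
      ho h1, ho (Ne.symm h1)]
    simp only [Derivation.smul_apply, Derivation.sub_apply, map_smul, map_sub, smul_eq_mul]
    ring

end Matrix

/-! ### Wick's theorem -/

section Wick

variable {H : Type} [Fintype H] [DecidableEq H]

/-- The involutions whose set of non-fixed points is `S`. -/
def pairingsOn (S : Finset H) : Finset (Perm H) :=
  {α | (∀ h, α (α h) = h) ∧ ∀ h, α h ≠ h ↔ h ∈ S}

theorem mem_pairingsOn {S : Finset H} {α : Perm H} :
    α ∈ pairingsOn S ↔ (∀ h, α (α h) = h) ∧ ∀ h, α h ≠ h ↔ h ∈ S := by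
  simp [pairingsOn]

theorem swap_mul_mem_pairingsOn {S : Finset H} {a b : H} {β : Perm H} (ha : a ∈ S) (hb : b ∈ S)
    (hab : a ≠ b) (hβ : β ∈ pairingsOn ((S.erase a).erase b)) :
    swap a b * β ∈ pairingsOn S := by
  rw [mem_pairingsOn] at hβ ⊢
  obtain ⟨h1, h2⟩ := hβ
  have ha' : β a = a := by simpa using (h2 a).not
  have hb' : β b = b := by simpa using (h2 b).not
  simp only [Finset.mem_erase] at h2
  have hna : ∀ h, β h = a → h = a := fun h e => by rw [← h1 h, e, ha']
  have hnb : ∀ h, β h = b → h = b := fun h e => by rw [← h1 h, e, hb']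
  constructor <;> intro h <;> simp only [Perm.mul_apply, swap_apply_def] <;> grind

theorem swap_mul_mem_pairingsOn_erase {S : Finset H} {a : H} {α : Perm H} (ha : a ∈ S)
    (hα : α ∈ pairingsOn S) :
    swap a (α a) * α ∈ pairingsOn ((S.erase a).erase (α a)) := by
  rw [mem_pairingsOn] at hα ⊢
  obtain ⟨h1, h2⟩ := hα
  simp only [Finset.mem_erase]
  have hna : ∀ h, α h = a → h = α a := fun h e => by rw [← e, h1]
  have hnb : ∀ h, α h = α a → h = a := fun h e => α.injective e
  constructor <;> intro h <;> simp only [Perm.mul_apply, swap_apply_def] <;> grind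

/-- Multiplication by `swap a b` is a bijection between the pairings of `S` matching `a` with `b`
and the pairings of the remaining points; the condition on the right is the constraint at `a` and
`b`. -/
theorem card_pairingsOn_filter_apply_eq {ι : Type*} [DecidableEq ι] (i j : H → ι) {S : Finset H}
    {a b : H} (ha : a ∈ S) (hb : b ∈ S.erase a) :
    Finset.card {α ∈ pairingsOn S | (∀ h ∈ S, i h = j (α h)) ∧ α a = b} =
      if i a = j b ∧ j a = i b then
        Finset.card {β ∈ pairingsOn ((S.erase a).erase b) |
          ∀ h ∈ (S.erase a).erase b, i h = j (β h)} else 0 := by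
  obtain ⟨hba, hb⟩ := Finset.mem_erase.mp hb
  split_ifs with hc
  · refine Finset.card_nbij' (fun α => swap a b * α) (fun β => swap a b * β) ?_ ?_ ?_ ?_
    · intro α hα
      simp only [Finset.coe_filter, Set.mem_ofPred_eq] at hα ⊢
      obtain ⟨h1, h2, rfl⟩ := hα
      refine ⟨swap_mul_mem_pairingsOn_erase ha h1, fun h hh => ?_⟩
      obtain ⟨h1, -⟩ := mem_pairingsOn.mp h1
      simp only [Finset.mem_erase] at hh
      rw [Perm.mul_apply, swap_apply_of_ne_of_ne]
      · exact h2 h hh.2.2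
      · intro e; exact hh.1 (by rw [← e, h1])
      · intro e; exact hh.2.1 (α.injective e)
    · intro β hβ
      simp only [Finset.coe_filter, Set.mem_ofPred_eq] at hβ ⊢
      obtain ⟨h1, h2⟩ := hβ
      refine ⟨swap_mul_mem_pairingsOn ha hb (Ne.symm hba) h1, ?_⟩
      obtain ⟨h1, h3⟩ := mem_pairingsOn.mp h1
      have ha' : β a = a := by simpa using (h3 a).not
      have hb' : β b = b := by simpa using (h3 b).not
      simp only [Finset.mem_erase] at h2
      have hna : ∀ h, β h = a → h = a := fun h e => by rw [← h1 h, e, ha']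
      have hnb : ∀ h, β h = b → h = b := fun h e => by rw [← h1 h, e, hb']
      refine ⟨fun h hh => ?_, by simp [ha']⟩
      simp only [Perm.mul_apply, swap_apply_def]
      grind
    · intro α _; simp [← mul_assoc]
    · intro β _; simp [← mul_assoc]
  · rw [Finset.card_eq_zero, Finset.filter_eq_empty_iff]
    rintro α hα ⟨h1, rfl⟩
    refine hc ⟨h1 a ha, ?_⟩
    rw [h1 _ hb, (mem_pairingsOn.mp hα).1]

theorem card_pairingsOn_filter {ι : Type*} [DecidableEq ι] (i j : H → ι) {S : Finset H}
    {a : H} (ha : a ∈ S) :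
    Finset.card {α ∈ pairingsOn S | ∀ h ∈ S, i h = j (α h)} =
      ∑ b ∈ S.erase a, if i a = j b ∧ j a = i b then
        Finset.card {β ∈ pairingsOn ((S.erase a).erase b) |
          ∀ h ∈ (S.erase a).erase b, i h = j (β h)} else 0 := by
  rw [Finset.card_eq_sum_card_fiberwise (f := fun α : Perm H => α a) (t := S.erase a)]
  · refine Finset.sum_congr rfl fun b hb => ?_
    rw [Finset.filter_filter, card_pairingsOn_filter_apply_eq i j ha hb]
  · intro α hα
    obtain ⟨h1, h2⟩ := mem_pairingsOn.mp (Finset.mem_filter.mp hα).1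
    have h3 := (h2 a).mpr ha
    refine Finset.mem_coe.mpr (Finset.mem_erase.mpr ⟨h3, (h2 _).mp ?_⟩)
    rw [h1]
    exact h3.symm

/-- Wick's theorem for the entries of a Gaussian Hermitian matrix. -/
theorem polyExpectation_prod_entryPoly {N : ℕ} (hN : 1 ≤ N) {t : ℝ} (ht : 0 < t)
    (i j : H → Fin N) (S : Finset H) :
    polyExpectation (coordRate_pos hN ht) (∏ h ∈ S, entryPoly (i h) (j h)) =
      ((t / N : ℝ) : ℂ) ^ (S.card / 2) *
        (Finset.card {α ∈ pairingsOn S | ∀ h ∈ S, i h = j (α h)} : ℂ) := by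
  induction hn : S.card using Nat.strong_induction_on generalizing S with
  | _ n ih =>
    rcases S.eq_empty_or_nonempty with rfl | ⟨a, ha⟩
    · have : pairingsOn (∅ : Finset H) = {1} := by
        ext α
        rw [mem_pairingsOn, Finset.mem_singleton, Perm.ext_iff]
        simp only [Finset.notMem_empty, iff_false, not_not, Perm.one_apply]
        exact ⟨fun h => h.2, fun h => ⟨fun x => by rw [h, h], h⟩⟩
      rw [← hn, this]
      simp [polyExpectation_one]
    -- Integration by parts contracts the entry at `a` with each other entry `b`, in step with the
    -- recursion on the partner of `a`. For odd `S.card` the rounding in `S.card / 2` is immaterial,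
    -- as there are no pairings.
    · rw [← Finset.mul_prod_erase _ _ ha, polyExpectation_entryPoly_mul hN ht,
        derivation_finset_prod, map_sum, card_pairingsOn_filter i j ha, Nat.cast_sum,
        Finset.mul_sum, Finset.mul_sum]
      refine Finset.sum_congr rfl fun b hb => ?_
      rw [entryDeriv_entryPoly]
      have hc : ((S.erase a).erase b).card + 2 = n := by
        have h1 := Finset.card_erase_add_one ha
        have h2 := Finset.card_erase_add_one hb
        omega
      split_ifs with h
      · rw [one_mul, ih _ (by omega) _ rfl, ← hc, Nat.add_div_right _ two_pos, pow_succ]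
        ring
      · simp

end Wick

/-! ### Expectations of products of traces -/

section Traces

variable {H : Type} [Fintype H] [DecidableEq H]

theorem mem_pairingsOn_univ {α : Perm H} : α ∈ pairingsOn Finset.univ ↔ IsPairing α := by
  rw [mem_pairingsOn]
  simp [IsPairing, Function.Involutive]

theorem prod_trace_eq_eval {N : ℕ} (σ : Perm H) (x : Fin N × Fin N → ℝ) :
    (σ.partition.parts.map fun n => (hermitianOf x ^ n).trace).prod =
      MvPolynomial.eval (fun p => (x p : ℂ))
        (∑ i : H → Fin N, ∏ h, entryPoly (i h) (i (σ h))) := by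
  rw [← sum_prod_perm_eq_prod_trace]
  simp [map_sum, map_prod, eval_entryPoly]

/-- Gluing polygons: the expectation of a product of traces is a sum over pairings. -/
theorem expectation_prod_trace {N : ℕ} (hN : 1 ≤ N) {t : ℝ} (ht : 0 < t) (σ : Perm H) :
    expectation N t (fun M => (σ.partition.parts.map fun n => (M ^ n).trace).prod) =
      ((t / N : ℝ) : ℂ) ^ (Fintype.card H / 2) *
        ∑ α ∈ pairingsOn (Finset.univ : Finset H), (N : ℂ) ^ numCycles (σ * α) := by
  have h : expectation N t (fun M => (σ.partition.parts.map fun n => (M ^ n).trace).prod) =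
      polyExpectation (coordRate_pos hN ht)
        (∑ i : H → Fin N, ∏ h, entryPoly (i h) (i (σ h))) := by
    simp only [expectation, prod_trace_eq_eval, gaussianMeasure_eq]
    rfl
  rw [h, map_sum]
  simp only [polyExpectation_prod_entryPoly hN ht, Finset.card_univ]
  rw [← Finset.mul_sum]
  congr 1
  simp only [Finset.card_filter, Nat.cast_sum]
  rw [Finset.sum_comm]
  refine Finset.sum_congr rfl fun α _ => ?_
  -- After exchanging the sums, the Wick constraint for fixed `α` says that `i` is invariant under
  -- `σ * α`.
  have h := card_colourings (ι := Fin N) (σ * α)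
  rw [Fintype.card_subtype, Finset.card_filter, Fintype.card_fin] at h
  rw [← Nat.cast_sum, ← Nat.cast_pow, ← h]
  simp only [Finset.mem_univ, true_imp_iff, Perm.mul_apply]
  congr!

end Traces

/-! ### The exponential formula -/

/-- `S` is an orbit of the group generated by `σ` and `α`. -/
def IsComponent {H : Type*} (σ α : Perm H) (S : Set H) : Prop :=
  S.Nonempty ∧ (∀ x ∈ S, σ x ∈ S) ∧ (∀ x ∈ S, α x ∈ S) ∧
    ∀ T ⊆ S, T.Nonempty → (∀ x ∈ T, σ x ∈ T) → (∀ x ∈ T, α x ∈ T) → T = S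

theorem IsComponent.eq {H : Type*} {σ α : Perm H} {S T : Set H} (hS : IsComponent σ α S)
    (hT : IsComponent σ α T) {h : H} (h1 : h ∈ S) (h2 : h ∈ T) : S = T := by
  have hσ : ∀ x ∈ S ∩ T, σ x ∈ S ∩ T := fun x hx => ⟨hS.2.1 x hx.1, hT.2.1 x hx.2⟩
  have hα : ∀ x ∈ S ∩ T, α x ∈ S ∩ T := fun x hx => ⟨hS.2.2.1 x hx.1, hT.2.2.1 x hx.2⟩
  rw [← hS.2.2.2 (S ∩ T) Set.inter_subset_left ⟨h, h1, h2⟩ hσ hα]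
  exact hT.2.2.2 (S ∩ T) Set.inter_subset_right ⟨h, h1, h2⟩ hσ hα

theorem exists_isComponent {H : Type*} [Finite H] (σ α : Perm H) (h : H) :
    ∃ S : Set H, h ∈ S ∧ IsComponent σ α S := by
  obtain ⟨S, ⟨hS, hσ, hα⟩, hmin⟩ := Set.Finite.exists_minimal
    (s := {S : Set H | h ∈ S ∧ (∀ x ∈ S, σ x ∈ S) ∧ ∀ x ∈ S, α x ∈ S}) (Set.toFinite _)
    ⟨Set.univ, by simp⟩
  refine ⟨S, hS, ⟨h, hS⟩, hσ, hα, fun T hTS hT hTσ hTα => hTS.antisymm ?_⟩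
  by_cases hhT : h ∈ T
  · exact hmin ⟨hhT, hTσ, hTα⟩ hTS
  · exfalso
    obtain ⟨x, hx⟩ := hT
    -- If a stable part `T` missed `h`, then `S \ T` would be a smaller stable set containing `h`.
    refine (hmin (y := S \ T) ⟨⟨hS, hhT⟩, fun y hy => ⟨hσ y hy.1, ?_⟩,
      fun y hy => ⟨hα y hy.1, ?_⟩⟩ Set.sdiff_subset (hTS hx)).2 hx
    · exact (apply_mem_iff_of_mapsTo hTσ y).not.mpr hy.2
    · exact (apply_mem_iff_of_mapsTo hTα y).not.mpr hy.2

theorem isComponent_subtypeCongr_iff {H : Type*} {p : H → Prop} [DecidablePred p]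
    (σ α : Perm {x // p x}) (σ' α' : Perm {x // ¬p x}) :
    IsComponent (σ.subtypeCongr σ') (α.subtypeCongr α') {x | p x} ↔ IsConnectedPair σ α := by
  constructor
  · rintro ⟨⟨a, ha⟩, -, -, hT⟩
    refine ⟨⟨⟨a, ha⟩⟩, fun T hne h1 h2 => ?_⟩
    have h := hT (Subtype.val '' T) (by rintro _ ⟨x, -, rfl⟩; exact x.2) (hne.image _) ?_ ?_
    · rw [Set.eq_univ_iff_forall]
      intro x
      have hx : x.1 ∈ Subtype.val '' T := h ▸ x.2
      obtain ⟨y, hy, hyx⟩ := hx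
      rwa [← Subtype.ext hyx]
    · rintro _ ⟨x, hx, rfl⟩
      rw [Perm.subtypeCongr.left_apply_subtype]
      exact ⟨_, h1 x hx, rfl⟩
    · rintro _ ⟨x, hx, rfl⟩
      rw [Perm.subtypeCongr.left_apply_subtype]
      exact ⟨_, h2 x hx, rfl⟩
  · rintro ⟨⟨a⟩, hT⟩
    refine ⟨⟨a.1, a.2⟩, fun x hx => ?_, fun x hx => ?_, fun T hTS hne h1 h2 => ?_⟩
    · rw [Perm.subtypeCongr.left_apply _ _ hx]; exact (σ ⟨x, hx⟩).2
    · rw [Perm.subtypeCongr.left_apply _ _ hx]; exact (α ⟨x, hx⟩).2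
    · have h := hT (Subtype.val ⁻¹' T) ?_ ?_ ?_
      · refine hTS.antisymm fun x hx => ?_
        exact Set.eq_univ_iff_forall.mp h ⟨x, hx⟩
      · obtain ⟨x, hx⟩ := hne
        exact ⟨⟨x, hTS hx⟩, hx⟩
      · intro x hx
        simpa [Perm.subtypeCongr.left_apply_subtype] using h1 x hx
      · intro x hx
        simpa [Perm.subtypeCongr.left_apply_subtype] using h2 x hx

theorem IsConnectedPair.permCongr {H H' : Type*} (e : H ≃ H') {σ α : Perm H}
    (h : IsConnectedPair σ α) : IsConnectedPair (e.permCongr σ) (e.permCongr α) := by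
  obtain ⟨⟨a⟩, hT⟩ := h
  refine ⟨⟨e a⟩, fun T ⟨y, hy⟩ h1 h2 => ?_⟩
  have := hT (e ⁻¹' T) ⟨e.symm y, by simpa using hy⟩
    (fun x hx => by simpa using h1 _ hx) (fun x hx => by simpa using h2 _ hx)
  rw [Set.eq_univ_iff_forall] at this ⊢
  exact fun x => by simpa using this (e.symm x)

theorem isConnectedPair_permCongr_iff {H H' : Type*} (e : H ≃ H') {σ α : Perm H} :
    IsConnectedPair (e.permCongr σ) (e.permCongr α) ↔ IsConnectedPair σ α := by
  refine ⟨fun h => ?_, fun h => h.permCongr e⟩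
  have := h.permCongr e.symm
  rwa [← Equiv.permCongr_symm, Equiv.symm_apply_apply, Equiv.symm_apply_apply] at this

section Exponential

variable {R : Type*} [CommRing R]
  (W : ∀ (H : Type) [Fintype H] [DecidableEq H], Perm H → Perm H → R)

/-- The sum of the weights of all pairs of permutations. -/
def pairSum (H : Type) [Fintype H] [DecidableEq H] : R := ∑ p : Perm H × Perm H, W H p.1 p.2

open Classical in
/-- The sum of the weights of the pairs of permutations generating a transitive group. -/
def connectedSum (H : Type) [Fintype H] [DecidableEq H] : R :=
  ∑ p : Perm H × Perm H with IsConnectedPair p.1 p.2, W H p.1 p.2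

variable {W}

theorem pairSum_congr (congr : ∀ (H H' : Type) [Fintype H] [DecidableEq H] [Fintype H']
      [DecidableEq H'] (e : H ≃ H') (σ α : Perm H),
      W H' (e.permCongr σ) (e.permCongr α) = W H σ α)
    {H H' : Type} [Fintype H] [DecidableEq H] [Fintype H'] [DecidableEq H'] (e : H ≃ H') :
    pairSum W H = pairSum W H' := by
  rw [pairSum, pairSum, ← (Equiv.prodCongr e.permCongr e.permCongr).sum_comp]
  exact Finset.sum_congr rfl fun p _ => (congr H H' e p.1 p.2).symm

theorem connectedSum_congr (congr : ∀ (H H' : Type) [Fintype H] [DecidableEq H] [Fintype H']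
      [DecidableEq H'] (e : H ≃ H') (σ α : Perm H),
      W H' (e.permCongr σ) (e.permCongr α) = W H σ α)
    {H H' : Type} [Fintype H] [DecidableEq H] [Fintype H'] [DecidableEq H'] (e : H ≃ H') :
    connectedSum W H = connectedSum W H' := by
  classical
  rw [connectedSum, connectedSum, Finset.sum_filter, Finset.sum_filter,
    ← (Equiv.prodCongr e.permCongr e.permCongr).sum_comp]
  refine Finset.sum_congr rfl fun p _ => ?_
  have h1 := congr H H' e p.1 p.2
  have h2 := isConnectedPair_permCongr_iff e (σ := p.1) (α := p.2)
  simp only [Equiv.prodCongr_apply, Prod.map_fst, Prod.map_snd, h1, h2]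

-- Both permutations preserve a component, so they restrict to it and to its complement: the
-- restriction to the component is connected, the rest is arbitrary, and `W` is multiplicative.
open Classical in
theorem sum_isComponent (union : ∀ (H : Type) [Fintype H] [DecidableEq H] (p : H → Prop)
      [DecidablePred p] (σ α : Perm {x // p x}) (σ' α' : Perm {x // ¬p x}),
      W H (σ.subtypeCongr σ') (α.subtypeCongr α') = W _ σ α * W _ σ' α')
    (H : Type) [Fintype H] [DecidableEq H] (p : H → Prop) [DecidablePred p] :
    ∑ q : Perm H × Perm H with IsComponent q.1 q.2 {x | p x}, W H q.1 q.2 =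
      connectedSum W {x // p x} * pairSum W {x // ¬p x} := by
  rw [connectedSum, pairSum, Finset.sum_mul_sum, ← Finset.sum_product']
  symm
  refine Finset.sum_bij (fun q _ => (q.1.1.subtypeCongr q.2.1, q.1.2.subtypeCongr q.2.2))
    ?_ ?_ ?_ ?_
  · rintro ⟨⟨σ, α⟩, σ', α'⟩ hq
    simp only [Finset.mem_product, Finset.mem_filter, Finset.mem_univ, true_and, and_true] at hq ⊢
    exact (isComponent_subtypeCongr_iff σ α σ' α').mpr hq
  · rintro ⟨⟨σ, α⟩, σ', α'⟩ - ⟨⟨τ, β⟩, τ', β'⟩ - h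
    obtain ⟨h1, h2⟩ := Prod.mk.inj h
    have hinj := Perm.subtypeCongrHom_injective p
    have e1 := @hinj (σ, σ') (τ, τ') h1
    have e2 := @hinj (α, α') (β, β') h2
    simp_all
  · rintro ⟨σ, α⟩ hq
    have hq' := (Finset.mem_filter.mp hq).2
    have hσ := apply_mem_iff_of_mapsTo hq'.2.1
    have hα := apply_mem_iff_of_mapsTo hq'.2.2.1
    have e1 := subtypeCongr_subtypePerm σ p hσ
    have e2 := subtypeCongr_subtypePerm α p hα
    refine ⟨((σ.subtypePerm hσ, α.subtypePerm hα),
      (σ.subtypePerm fun x => (hσ x).not, α.subtypePerm fun x => (hα x).not)), ?_, ?_⟩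
    · rw [Finset.mem_product]
      refine ⟨Finset.mem_filter.mpr ⟨Finset.mem_univ _, ?_⟩, Finset.mem_univ _⟩
      rw [← isComponent_subtypeCongr_iff (p := p) _ _ (σ.subtypePerm fun x => (hσ x).not)
        (α.subtypePerm fun x => (hα x).not), e1, e2]
      exact hq'
    · exact Prod.ext e1 e2
  · rintro ⟨⟨σ, α⟩, σ', α'⟩ -
    exact (union H p σ α σ' α').symm

-- Double counting: each half-edge lies in exactly one component.
open Classical in
theorem card_mul_eq_sum_isComponent {H : Type*} [Fintype H] (σ α : Perm H) :
    Fintype.card H = ∑ S : Finset H, if IsComponent σ α {x | x ∈ S} then S.card else 0 := by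
  have h1 : ∀ h : H, ∑ S : Finset H,
      (if IsComponent σ α {x | x ∈ S} ∧ h ∈ S then 1 else 0) = 1 := by
    intro h
    obtain ⟨S, hS, hc⟩ := exists_isComponent σ α h
    rw [Finset.sum_eq_single S.toFinset]
    · simp [hS, hc]
    · intro T _ hT
      rw [if_neg]
      rintro ⟨h2, h3⟩
      refine hT ?_
      have := hc.eq h2 hS h3
      ext x
      simp [this]
    · simp
  rw [Fintype.card_eq_sum_ones, Finset.sum_congr rfl fun h _ => (h1 h).symm, Finset.sum_comm]
  refine Finset.sum_congr rfl fun S _ => ?_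
  split_ifs with hS
  · simp only [hS, true_and]
    simp
  · simp only [hS, false_and]
    simp

/-- The exponential formula: `n a_n = ∑ (n choose j) j c_j a_{n-j}`, where `a` counts all
structures and `c` the connected ones. -/
theorem exponential_formula
    (congr : ∀ (H H' : Type) [Fintype H] [DecidableEq H] [Fintype H']
      [DecidableEq H'] (e : H ≃ H') (σ α : Perm H),
      W H' (e.permCongr σ) (e.permCongr α) = W H σ α)
    (union : ∀ (H : Type) [Fintype H] [DecidableEq H] (p : H → Prop)
      [DecidablePred p] (σ α : Perm {x // p x}) (σ' α' : Perm {x // ¬p x}),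
      W H (σ.subtypeCongr σ') (α.subtypeCongr α') = W _ σ α * W _ σ' α') (n : ℕ) :
    (n : R) * pairSum W (Fin n) = ∑ j ∈ Finset.range (n + 1),
      (n.choose j : R) * (j * connectedSum W (Fin j) * pairSum W (Fin (n - j))) := by
  classical
  have h1 : (n : R) * pairSum W (Fin n) = ∑ S ∈ (Finset.univ : Finset (Fin n)).powerset,
      (S.card : R) * connectedSum W (Fin S.card) * pairSum W (Fin (n - S.card)) := by
    rw [pairSum, Finset.mul_sum]
    -- The factor `n` marks a half-edge, and the marked half-edge selects its component `S`.
    have h2 : ∀ q : Perm (Fin n) × Perm (Fin n), (n : R) * W (Fin n) q.1 q.2 =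
        ∑ S : Finset (Fin n), if IsComponent q.1 q.2 {x | x ∈ S} then
          (S.card : R) * W (Fin n) q.1 q.2 else 0 := by
      intro q
      have h3 := congrArg (Nat.cast (R := R)) (card_mul_eq_sum_isComponent q.1 q.2)
      rw [Fintype.card_fin] at h3
      rw [h3, Nat.cast_sum, Finset.sum_mul]
      refine Finset.sum_congr rfl fun S _ => ?_
      split_ifs <;> simp
    rw [Finset.sum_congr rfl fun q _ => h2 q, Finset.sum_comm, Finset.powerset_univ]
    refine Finset.sum_congr rfl fun S _ => ?_
    rw [← Finset.sum_filter, ← Finset.mul_sum, mul_assoc,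
      sum_isComponent union (Fin n) fun x => x ∈ S]
    have e : {x // x ∈ S} ≃ Fin S.card := S.equivFin
    have e' : {x // x ∉ S} ≃ Fin (n - S.card) :=
      Fintype.equivFinOfCardEq (by rw [Fintype.card_subtype_compl]; simp)
    rw [pairSum_congr congr e']
    congr 2
    exact @connectedSum_congr R _ W congr _ _ (Subtype.fintype _) _ _ _ e
  rw [h1, Finset.sum_powerset_apply_card
    (fun j => (j : R) * connectedSum W (Fin j) * pairSum W (Fin (n - j)))]
  simp [nsmul_eq_mul]

end Exponential

/-! ### Vertex degrees -/

section VertexDegrees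

variable {H : Type} [Fintype H] [DecidableEq H]

/-- The vertex degrees `n ↦ c_n(σ)`. -/
def vertexDegrees (σ : Perm H) : ℕ+ →₀ ℕ :=
  Multiset.toFinsupp (σ.partition.parts.map Nat.toPNat')

theorem map_coe_map_toPNat' {m : Multiset ℕ} (h : ∀ i ∈ m, 0 < i) :
    (m.map Nat.toPNat').map (fun n : ℕ+ => (n : ℕ)) = m := by
  rw [Multiset.map_map]
  conv_rhs => rw [← Multiset.map_id m]
  exact Multiset.map_congr rfl fun i hi => by simp [h i hi]

theorem map_toPNat'_map_coe (m : Multiset ℕ+) :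
    (m.map (fun n : ℕ+ => (n : ℕ))).map Nat.toPNat' = m := by
  rw [Multiset.map_map]
  conv_rhs => rw [← Multiset.map_id m]
  exact Multiset.map_congr rfl fun i _ => by simp

theorem vertexDegrees_eq_iff (σ : Perm H) (k : ℕ+ →₀ ℕ) :
    vertexDegrees σ = k ↔
      σ.partition.parts = (Finsupp.toMultiset k).map (fun n : ℕ+ => (n : ℕ)) := by
  constructor
  · rintro rfl
    rw [vertexDegrees, Multiset.toFinsupp_toMultiset,
      map_coe_map_toPNat' fun i hi => σ.partition.parts_pos hi]
  · intro h
    rw [vertexDegrees, h, map_toPNat'_map_coe, Finsupp.toMultiset_toFinsupp]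

theorem parts_eq (σ : Perm H) : σ.partition.parts =
    (Finsupp.toMultiset (vertexDegrees σ)).map (fun n : ℕ+ => (n : ℕ)) :=
  (vertexDegrees_eq_iff σ _).mp rfl

theorem prod_parts {R : Type*} [CommMonoid R] (f : ℕ → R) (k : ℕ+ →₀ ℕ) :
    (((Finsupp.toMultiset k).map (fun n : ℕ+ => (n : ℕ))).map f).prod =
      k.prod fun n c => f n ^ c := by
  rw [Multiset.map_map, Finset.prod_multiset_map_count, Finsupp.toFinset_toMultiset, Finsupp.prod]
  exact Finset.prod_congr rfl fun n _ => by simp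

theorem wt_eq_sum (k : ℕ+ →₀ ℕ) :
    wt k = ((Finsupp.toMultiset k).map (fun n : ℕ+ => (n : ℕ))).sum := by
  rw [Finset.sum_multiset_map_count, Finsupp.toFinset_toMultiset, wt, Finsupp.weight_apply,
    Finsupp.sum]
  exact Finset.sum_congr rfl fun n _ => by simp

theorem wt_vertexDegrees (σ : Perm H) : wt (vertexDegrees σ) = Fintype.card H := by
  rw [wt_eq_sum, ← parts_eq, σ.partition.parts_sum]

theorem vertexDegrees_permCongr {H' : Type} [Fintype H'] [DecidableEq H'] (e : H ≃ H')
    (σ : Perm H) : vertexDegrees (e.permCongr σ) = vertexDegrees σ := by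
  rw [vertexDegrees, vertexDegrees, parts_permCongr]

theorem vertexDegrees_subtypeCongr {p : H → Prop} [DecidablePred p] (σ : Perm {x // p x})
    (τ : Perm {x // ¬p x}) :
    vertexDegrees (σ.subtypeCongr τ) = vertexDegrees σ + vertexDegrees τ := by
  rw [vertexDegrees, parts_subtypeCongr, Multiset.map_add, map_add]
  rfl

theorem vertexWeight_eq (σ : Perm H) :
    vertexWeight σ = MvPolynomial.monomial (vertexDegrees σ) 1 := by
  have h : vertexWeight σ =
      (σ.partition.parts.map fun n => (MvPolynomial.X n.toPNat' : MvPolynomial ℕ+ ℚ)).prod := by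
    rw [Finset.prod_multiset_map_count, vertexWeight]
    have hsub : σ.partition.parts.toFinset ⊆
        (Finset.range (Fintype.card H)).image Nat.succ := by
      intro i hi
      rw [Multiset.mem_toFinset] at hi
      have h1 := σ.partition.parts_pos hi
      have h2 := Multiset.le_sum_of_mem hi
      rw [σ.partition.parts_sum] at h2
      exact Finset.mem_image.mpr ⟨i - 1, Finset.mem_range.mpr (by omega), by omega⟩
    rw [Finset.prod_subset hsub fun i _ hi => by
      rw [Multiset.count_eq_zero.mpr (by simpa using hi), pow_zero],
      Finset.prod_image Nat.succ_injective.injOn]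
    rfl
  rw [h, parts_eq, prod_parts, MvPolynomial.monomial_eq, map_one, one_mul]
  exact Finset.prod_congr rfl fun n _ => by simp

/-- The number of permutations with given vertex degrees. -/
theorem card_vertexDegrees_mul_eq (k : ℕ+ →₀ ℕ) :
    Finset.card {σ : Perm (Fin (wt k)) | vertexDegrees σ = k} *
      (k.prod fun n c => (n : ℕ) ^ c * c.factorial) = (wt k).factorial := by
  set m := (Finsupp.toMultiset k).map (fun n : ℕ+ => (n : ℕ)) with hm
  set m' := m.filter (2 ≤ ·) with hm'
  have hpos : ∀ i ∈ m, 0 < i := by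
    intro i hi
    obtain ⟨n, -, rfl⟩ := Multiset.mem_map.mp hi
    exact n.pos
  -- Cycle types ignore fixed points, so the parts equal to `1` are separated; they account for the
  -- factor `(m.count 1)!` in the centralizer order.
  have hsplit : m = m' + Multiset.replicate (m.count 1) 1 := by
    conv_lhs => rw [← Multiset.filter_add_not (2 ≤ ·) m]
    congr 1
    rw [← Multiset.filter_eq' m 1]
    refine Multiset.filter_congr fun i hi => ?_
    have := hpos i hi
    omega
  have hsum : m'.sum + m.count 1 = wt k := by
    rw [wt_eq_sum, ← hm]
    conv_rhs => rw [hsplit]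
    simp
  have hiff : ∀ σ : Perm (Fin (wt k)), vertexDegrees σ = k ↔ σ.cycleType = m' := by
    intro σ
    rw [vertexDegrees_eq_iff, ← hm]
    constructor
    · intro h
      rw [hm', ← h, Perm.filter_parts_partition_eq_cycleType]
    · intro h
      rw [Perm.parts_partition, ← Perm.sum_cycleType, h, Fintype.card_fin,
        show wt k - m'.sum = m.count 1 by omega, ← hsplit]
  have hcard := Perm.card_of_cycleType_mul_eq (Fin (wt k)) m'
  rw [if_pos ⟨by rw [Fintype.card_fin]; omega, fun a ha => (Multiset.mem_filter.mp ha).2⟩,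
    Fintype.card_fin] at hcard
  rw [← hcard]
  simp only [hiff]
  congr 1
  rw [Finsupp.prod_mul, ← prod_parts (fun n => n), ← hm, Multiset.map_id',
    show wt k - m'.sum = m.count 1 by omega]
  have hprod : m.prod = m'.prod := by
    conv_lhs => rw [hsplit]
    simp
  have hfac : (k.prod fun _ c => c.factorial) = ∏ i ∈ m.toFinset, (m.count i).factorial := by
    rw [hm, Multiset.toFinset_map, Finset.prod_image PNat.coe_injective.injOn,
      Finsupp.toFinset_toMultiset, Finsupp.prod]
    refine Finset.prod_congr rfl fun n _ => ?_
    rw [Multiset.count_map_eq_count' _ _ PNat.coe_injective, Finsupp.count_toMultiset]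
  have hfac' : ∏ i ∈ m.toFinset, (m.count i).factorial =
      (m.count 1).factorial * ∏ i ∈ m'.toFinset, (m'.count i).factorial := by
    have h1 : ∏ i ∈ m.toFinset, (m.count i).factorial =
        ∏ i ∈ insert 1 m.toFinset, (m.count i).factorial := by
      refine Finset.prod_subset (Finset.subset_insert _ _) fun i _ hi => ?_
      rw [Multiset.count_eq_zero.mpr (by simpa using hi), Nat.factorial_zero]
    rw [h1, ← Finset.mul_prod_erase _ _ (Finset.mem_insert_self 1 _)]
    congr 1
    have h2 : (insert 1 m.toFinset).erase 1 = m'.toFinset := by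
      ext i
      simp only [Finset.mem_erase, Finset.mem_insert, Multiset.mem_toFinset, hm',
        Multiset.mem_filter]
      constructor
      · rintro ⟨h1, h2⟩
        have h3 := h2.resolve_left h1
        have := hpos i h3
        exact ⟨h3, by omega⟩
      · rintro ⟨h1, h2⟩
        exact ⟨by omega, Or.inr h1⟩
    rw [h2]
    refine Finset.prod_congr rfl fun i hi => ?_
    rw [Multiset.mem_toFinset, hm', Multiset.mem_filter] at hi
    rw [hm', Multiset.count_filter_of_pos hi.2]
  rw [hfac, hfac', hprod]
  ring

theorem exists_vertexDegrees_eq (k : ℕ+ →₀ ℕ) :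
    ∃ σ : Perm (Fin (wt k)), vertexDegrees σ = k := by
  have h := card_vertexDegrees_mul_eq k
  have h1 : 0 < Finset.card {σ : Perm (Fin (wt k)) | vertexDegrees σ = k} := by
    rw [Nat.pos_iff_ne_zero]
    intro h0
    rw [h0, zero_mul] at h
    exact Nat.factorial_ne_zero _ h.symm
  obtain ⟨σ, hσ⟩ := Finset.card_pos.mp h1
  exact ⟨σ, (Finset.mem_filter.mp hσ).2⟩

end VertexDegrees

/-! ### The weights of maps -/

section Weights

theorem numCycles_permCongr {H H' : Type} [Fintype H] [DecidableEq H] [Fintype H']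
    [DecidableEq H'] (e : H ≃ H') (σ : Perm H) : numCycles (e.permCongr σ) = numCycles σ := by
  rw [numCycles, numCycles, parts_permCongr]

theorem numCycles_subtypeCongr {H : Type} [Fintype H] [DecidableEq H] {p : H → Prop}
    [DecidablePred p] (σ : Perm {x // p x}) (τ : Perm {x // ¬p x}) :
    numCycles (σ.subtypeCongr τ) = numCycles σ + numCycles τ := by
  rw [numCycles, parts_subtypeCongr, Multiset.card_add]
  rfl

theorem permCongr_mul {H H' : Type*} (e : H ≃ H') (σ α : Perm H) :
    e.permCongr σ * e.permCongr α = e.permCongr (σ * α) := by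
  ext x
  simp

theorem subtypeCongr_mul {H : Type*} {p : H → Prop} [DecidablePred p] (σ α : Perm {x // p x})
    (σ' α' : Perm {x // ¬p x}) :
    σ.subtypeCongr σ' * α.subtypeCongr α' = (σ * α).subtypeCongr (σ' * α') :=
  (map_mul (Perm.subtypeCongrHom p) (σ, σ') (α, α')).symm

theorem isPairing_permCongr_iff {H H' : Type*} (e : H ≃ H') {α : Perm H} :
    IsPairing (e.permCongr α) ↔ IsPairing α := by
  unfold IsPairing Function.Involutive
  rw [← e.forall_congr_right, ← e.forall_congr_right]
  simp

theorem isPairing_subtypeCongr_iff {H : Type*} {p : H → Prop} [DecidablePred p]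
    {α : Perm {x // p x}} {α' : Perm {x // ¬p x}} :
    IsPairing (α.subtypeCongr α') ↔ IsPairing α ∧ IsPairing α' := by
  constructor
  · rintro ⟨h1, h2⟩
    refine ⟨⟨fun x => ?_, fun x hx => h2 x ?_⟩, ⟨fun x => ?_, fun x hx => h2 x ?_⟩⟩
    · simpa [Perm.subtypeCongr.left_apply_subtype, Subtype.ext_iff] using h1 x
    · rw [Perm.subtypeCongr.left_apply_subtype, hx]
    · simpa [Perm.subtypeCongr.right_apply_subtype, Subtype.ext_iff] using h1 x
    · rw [Perm.subtypeCongr.right_apply_subtype, hx]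
  · rintro ⟨⟨h1, h2⟩, h3, h4⟩
    refine ⟨fun x => ?_, fun x hx => ?_⟩ <;> by_cases hp : p x
    · rw [Perm.subtypeCongr.left_apply _ _ hp, Perm.subtypeCongr.left_apply_subtype, h1]
    · rw [Perm.subtypeCongr.right_apply _ _ hp, Perm.subtypeCongr.right_apply_subtype, h3]
    · rw [Perm.subtypeCongr.left_apply _ _ hp] at hx
      exact h2 ⟨x, hp⟩ (Subtype.ext hx)
    · rw [Perm.subtypeCongr.right_apply _ _ hp] at hx
      exact h4 ⟨x, hp⟩ (Subtype.ext hx)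

open Classical in
/-- The weight of a map, with `N` per unit of Euler characteristic and `t` per edge. -/
def mapWeight (N : ℕ) (t : ℝ) (H : Type) [Fintype H] [DecidableEq H] (σ α : Perm H) :
    MvPolynomial ℕ+ ℂ :=
  if IsPairing α then
    MvPolynomial.monomial (vertexDegrees σ) ((N : ℂ) ^ eulerChar σ α * (t : ℂ) ^ numCycles α)
  else 0

theorem mapWeight_permCongr (N : ℕ) (t : ℝ) (H H' : Type) [Fintype H] [DecidableEq H] [Fintype H']
    [DecidableEq H'] (e : H ≃ H') (σ α : Perm H) :
    mapWeight N t H' (e.permCongr σ) (e.permCongr α) = mapWeight N t H σ α := by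
  have h := isPairing_permCongr_iff e (α := α)
  rw [mapWeight, mapWeight]
  by_cases hα : IsPairing α
  · rw [if_pos hα, if_pos (h.mpr hα)]
    simp only [vertexDegrees_permCongr, eulerChar, permCongr_mul, numCycles_permCongr]
  · rw [if_neg hα, if_neg (h.not.mpr hα)]

theorem mapWeight_subtypeCongr {N : ℕ} (hN : 1 ≤ N) (t : ℝ) (H : Type) [Fintype H] [DecidableEq H]
    (p : H → Prop) [DecidablePred p] (σ α : Perm {x // p x}) (σ' α' : Perm {x // ¬p x}) :
    mapWeight N t H (σ.subtypeCongr σ') (α.subtypeCongr α') =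
      mapWeight N t _ σ α * mapWeight N t _ σ' α' := by
  have hN' : (N : ℂ) ≠ 0 := by exact_mod_cast (by omega : N ≠ 0)
  have h := isPairing_subtypeCongr_iff (α := α) (α' := α')
  rw [mapWeight, mapWeight, mapWeight]
  by_cases h1 : IsPairing α
  swap
  · rw [if_neg h1, zero_mul, if_neg fun h' => h1 (h.mp h').1]
  by_cases h2 : IsPairing α'
  swap
  · rw [if_neg h2, mul_zero, if_neg fun h' => h2 (h.mp h').2]
  rw [if_pos h1, if_pos h2, if_pos (h.mpr ⟨h1, h2⟩), MvPolynomial.monomial_mul, vertexDegrees_subtypeCongr]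
  congr 1
  simp only [eulerChar, subtypeCongr_mul, numCycles_subtypeCongr]
  rw [show ((numCycles σ + numCycles σ' : ℕ) : ℤ) - ((numCycles α + numCycles α' : ℕ) : ℤ) +
    ((numCycles (σ * α) + numCycles (σ' * α') : ℕ) : ℤ) =
    (numCycles σ - numCycles α + numCycles (σ * α) : ℤ) +
      (numCycles σ' - numCycles α' + numCycles (σ' * α') : ℤ) by push_cast; ring,
    zpow_add₀ hN', pow_add]
  ring

theorem coeff_mapWeight_eq_zero (N : ℕ) (t : ℝ) {H : Type} [Fintype H] [DecidableEq H]
    (σ α : Perm H) {k : ℕ+ →₀ ℕ} (hk : wt k ≠ Fintype.card H) :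
    MvPolynomial.coeff k (mapWeight N t H σ α) = 0 := by
  rw [mapWeight]
  split_ifs
  · rw [MvPolynomial.coeff_monomial, if_neg]
    rintro rfl
    exact hk (wt_vertexDegrees σ)
  · simp

theorem coeff_connectedSum_eq_zero (N : ℕ) (t : ℝ) {n : ℕ} {k : ℕ+ →₀ ℕ} (hk : wt k ≠ n) :
    MvPolynomial.coeff k (connectedSum (mapWeight N t) (Fin n)) = 0 := by
  rw [connectedSum, MvPolynomial.coeff_sum]
  exact Finset.sum_eq_zero fun p _ => coeff_mapWeight_eq_zero N t _ _ (by simpa using hk)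

/-- The generating series of all maps. -/
def mapSeries (N : ℕ) (t : ℝ) : MvPowerSeries ℕ+ ℂ := fun k =>
  ((wt k).factorial : ℂ)⁻¹ * MvPolynomial.coeff k (pairSum (mapWeight N t) (Fin (wt k)))

/-- The generating series of connected maps. -/
def connectedMapSeries (N : ℕ) (t : ℝ) : MvPowerSeries ℕ+ ℂ := fun k =>
  ((wt k).factorial : ℂ)⁻¹ * MvPolynomial.coeff k (connectedSum (mapWeight N t) (Fin (wt k)))

/-- This is the exponential formula with `n = wt k`, read at the coefficient of `k`. The connected
sum on `j` points is homogeneous of weight `j`, so only `j = wt q.1` survives, and the binomial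
coefficient turns into the factorials of the two series. -/
theorem weightDeriv_connectedMapSeries_mul {N : ℕ} (hN : 1 ≤ N) (t : ℝ) :
    weightDeriv (connectedMapSeries N t) * mapSeries N t = weightDeriv (mapSeries N t) := by
  ext k
  have h := congrArg (MvPolynomial.coeff k) (exponential_formula (mapWeight_permCongr N t)
    (mapWeight_subtypeCongr hN t) (wt k))
  have hC : ∀ (n : ℕ) (P : MvPolynomial ℕ+ ℂ),
      MvPolynomial.coeff k ((n : MvPolynomial ℕ+ ℂ) * P) = n * MvPolynomial.coeff k P := by
    intro n P
    rw [← map_natCast (MvPolynomial.C : ℂ →+* MvPolynomial ℕ+ ℂ), MvPolynomial.coeff_C_mul]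
  simp only [hC, MvPolynomial.coeff_sum, mul_assoc] at h
  rw [coeff_weightDeriv]
  change _ = (wt k : ℂ) * (_ * _)
  rw [mul_left_comm, h, Finset.mul_sum, MvPowerSeries.coeff_mul]
  simp only [MvPolynomial.coeff_mul, Finset.mul_sum]
  rw [Finset.sum_comm]
  refine Finset.sum_congr rfl fun q hq => ?_
  have hq' := congrArg wt (Finset.HasAntidiagonal.mem_antidiagonal.mp hq)
  rw [map_add] at hq'
  rw [Finset.sum_eq_single (wt q.1)]
  · rw [coeff_weightDeriv]
    change (wt q.1 : ℂ) * (_ * _) * (_ * _) = _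
    have h2 : wt k - wt q.1 = wt q.2 := by omega
    rw [h2, ← hq', Nat.cast_add_choose]
    have f1 : ((wt q.1 + wt q.2).factorial : ℂ) ≠ 0 := by exact_mod_cast Nat.factorial_ne_zero _
    have f2 : ((wt q.1).factorial : ℂ) ≠ 0 := by exact_mod_cast Nat.factorial_ne_zero _
    have f3 : ((wt q.2).factorial : ℂ) ≠ 0 := by exact_mod_cast Nat.factorial_ne_zero _
    field_simp
  · intro j _ hj
    rw [coeff_connectedSum_eq_zero N t hj.symm]
    ring
  · intro hj
    exact absurd (Finset.mem_range.mpr (by omega)) hj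

end Weights

/-! ### The partition function -/

section PartitionFunction

theorem prod_trace_eq {N : ℕ} (M : Matrix (Fin N) (Fin N) ℂ) (k : ℕ+ →₀ ℕ)
    {σ : Perm (Fin (wt k))} (hσ : vertexDegrees σ = k) :
    (σ.partition.parts.map fun n => (M ^ n).trace).prod =
      k.prod fun n c => (M ^ (n : ℕ)).trace ^ c := by
  rw [parts_eq, hσ, prod_parts]

/-- The coefficient of `exp (N Tr V(M))` is a multiple of a product of traces. -/
theorem coeff_expTraceV_mul {N : ℕ} (M : Matrix (Fin N) (Fin N) ℂ) (k : ℕ+ →₀ ℕ)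
    {σ : Perm (Fin (wt k))} (hσ : vertexDegrees σ = k) :
    MvPowerSeries.coeff k (expTraceV M) =
      (N : ℂ) ^ numCycles σ * ((k.prod fun n c => (n : ℕ) ^ c * c.factorial : ℕ) : ℂ)⁻¹ *
        (σ.partition.parts.map fun n => (M ^ n).trace).prod := by
  have hN : (N : ℂ) ^ numCycles σ = k.prod fun _ c => (N : ℂ) ^ c := by
    rw [← prod_parts fun _ => (N : ℂ), ← (vertexDegrees_eq_iff σ k).mp hσ, Multiset.map_const',
      Multiset.prod_replicate, numCycles]
  rw [coeff_expTraceV, prod_trace_eq M k hσ, hN]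
  simp only [Finsupp.prod]
  push_cast
  rw [← Finset.prod_inv_distrib, ← Finset.prod_mul_distrib, ← Finset.prod_mul_distrib]
  refine Finset.prod_congr rfl fun n _ => ?_
  rw [div_pow, mul_pow, mul_inv]
  ring

theorem integrable_coeff_expTraceV {N : ℕ} (hN : 1 ≤ N) {t : ℝ} (ht : 0 < t) (k : ℕ+ →₀ ℕ) :
    Integrable (fun x => MvPowerSeries.coeff k (expTraceV (hermitianOf x)))
      (gaussianMeasure N t) := by
  obtain ⟨σ, hσ⟩ := exists_vertexDegrees_eq k
  simp only [coeff_expTraceV_mul _ k hσ, prod_trace_eq_eval, gaussianMeasure_eq]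
  exact (integrable_eval_piGaussian (coordRate_pos hN ht) _).const_mul _

/-- With `m` edges, the powers `N ^ numCycles σ`, `N ^ (-m)` and `N ^ numCycles (σ * α)` combine
into `N` to the Euler characteristic. -/
theorem coeff_pairSum {N : ℕ} (hN : 1 ≤ N) {t : ℝ} (ht : 0 < t) (k : ℕ+ →₀ ℕ) :
    MvPolynomial.coeff k (pairSum (mapWeight N t) (Fin (wt k))) =
      ∑ σ : Perm (Fin (wt k)) with vertexDegrees σ = k, (N : ℂ) ^ numCycles σ *
        expectation N t (fun M => (σ.partition.parts.map fun n => (M ^ n).trace).prod) := by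
  have hN' : (N : ℂ) ≠ 0 := by exact_mod_cast (by omega : N ≠ 0)
  rw [pairSum, MvPolynomial.coeff_sum, Fintype.sum_prod_type, Finset.sum_filter]
  refine Finset.sum_congr rfl fun σ _ => ?_
  rw [expectation_prod_trace hN ht]
  by_cases hσ : vertexDegrees σ = k
  · rw [if_pos hσ, Finset.mul_sum, Finset.mul_sum,
      ← Finset.sum_subset (Finset.subset_univ (pairingsOn Finset.univ))]
    · refine Finset.sum_congr rfl fun α hα => ?_
      rw [mem_pairingsOn_univ] at hα
      have hα' := hα.two_mul_numCycles
      rw [mapWeight, if_pos hα, MvPolynomial.coeff_monomial, if_pos hσ, ← hα',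
        Nat.mul_div_cancel_left _ two_pos, eulerChar, zpow_add₀ hN', zpow_sub₀ hN']
      simp only [zpow_natCast]
      push_cast
      rw [div_pow]
      ring
    · intro α _ hα
      rw [mem_pairingsOn_univ] at hα
      rw [mapWeight, if_neg hα, MvPolynomial.coeff_zero]
  · rw [if_neg hσ]
    refine Finset.sum_eq_zero fun α _ => ?_
    rw [mapWeight]
    split_ifs
    · rw [MvPolynomial.coeff_monomial, if_neg hσ]
    · exact MvPolynomial.coeff_zero k

/-- The partition function is the generating series of all maps. -/
theorem partitionFunction_eq {N : ℕ} (hN : 1 ≤ N) {t : ℝ} (ht : 0 < t) :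
    partitionFunction N t = mapSeries N t := by
  ext k
  change expectation N t (fun M => MvPowerSeries.coeff k (expTraceV M)) = _ * _
  set c : ℂ := ((k.prod fun n c => (n : ℕ) ^ c * c.factorial : ℕ) : ℂ) with hc
  -- All `σ` with vertex degrees `k` contribute equally, and their number times `c` is `(wt k)!`.
  have hconst : ∀ σ : Perm (Fin (wt k)), vertexDegrees σ = k → (N : ℂ) ^ numCycles σ *
      expectation N t (fun M => (σ.partition.parts.map fun n => (M ^ n).trace).prod) =
      c * expectation N t (fun M => MvPowerSeries.coeff k (expTraceV M)) := by
    intro σ hσ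
    have hc0 : c ≠ 0 := by
      have h := card_vertexDegrees_mul_eq k
      rw [hc]
      intro h0
      rw [Nat.cast_eq_zero.mp h0, mul_zero] at h
      exact Nat.factorial_ne_zero _ h.symm
    have h : expectation N t (fun M => MvPowerSeries.coeff k (expTraceV M)) =
        (N : ℂ) ^ numCycles σ * c⁻¹ *
          expectation N t (fun M => (σ.partition.parts.map fun n => (M ^ n).trace).prod) := by
      simp only [expectation, coeff_expTraceV_mul _ k hσ, integral_const_mul, hc]
    rw [h]
    field_simp
  have hcard := congrArg (Nat.cast (R := ℂ)) (card_vertexDegrees_mul_eq k)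
  rw [Nat.cast_mul, ← hc] at hcard
  rw [coeff_pairSum hN ht, Finset.sum_congr rfl fun σ hσ => hconst σ (Finset.mem_filter.mp hσ).2,
    Finset.sum_const, nsmul_eq_mul, ← mul_assoc, ← mul_assoc, mul_assoc _ _ c, hcard,
    inv_mul_cancel₀ (by exact_mod_cast Nat.factorial_ne_zero _), one_mul]

theorem constantCoeff_partitionFunction {N : ℕ} (hN : 1 ≤ N) {t : ℝ} (ht : 0 < t) :
    MvPowerSeries.constantCoeff (partitionFunction N t) = 1 := by
  have : IsProbabilityMeasure (gaussianMeasure N t) := by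
    rw [gaussianMeasure_eq]
    exact isProbabilityMeasure_piGaussian (coordRate_pos hN ht)
  rw [← MvPowerSeries.coeff_zero_eq_constantCoeff_apply]
  change expectation N t (fun M => MvPowerSeries.coeff 0 (expTraceV M)) = 1
  simp [expectation, coeff_expTraceV]

theorem freeEnergy_eq {N : ℕ} (hN : 1 ≤ N) {t : ℝ} (ht : 0 < t) :
    freeEnergy N t = connectedMapSeries N t := by
  classical
  refine log_subst_eq ?_ ?_ (constantCoeff_partitionFunction hN ht)
  · rw [partitionFunction_eq hN ht]
    exact weightDeriv_connectedMapSeries_mul hN t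
  · rw [← MvPowerSeries.coeff_zero_eq_constantCoeff_apply]
    change _ * _ = (0 : ℂ)
    -- A connected pair needs a nonempty set of half-edges, so the series has no constant term.
    have h : connectedSum (mapWeight N t) (Fin (wt 0)) = 0 := by
      rw [connectedSum]
      refine Finset.sum_eq_zero fun p hp => ?_
      obtain ⟨a⟩ := (Finset.mem_filter.mp hp).2.1
      exact absurd a.2 (by simp)
    rw [h, MvPolynomial.coeff_zero, mul_zero]

end PartitionFunction

/-! ### The sum over genera -/

section Genera

theorem mem_labelledMaps {g m : ℕ} {p : Perm (Fin (2 * m)) × Perm (Fin (2 * m))} :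
    p ∈ labelledMaps g m ↔
      (IsPairing p.2 ∧ IsConnectedPair p.1 p.2) ∧ eulerChar p.1 p.2 = 2 - 2 * (g : ℤ) := by
  classical
  rw [labelledMaps, Finset.mem_filter, isCombinatorialMap_iff]
  simp

/-- The Euler characteristic is at least `-m`. This crude bound suffices for finiteness. -/
theorem genus_le {m : ℕ} {σ α : Perm (Fin (2 * m))} (hα : IsPairing α) {g : ℕ}
    (h : eulerChar σ α = 2 - 2 * (g : ℤ)) : g ≤ m + 1 := by
  have h1 := hα.two_mul_numCycles
  rw [Fintype.card_fin] at h1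
  rw [eulerChar] at h
  omega

theorem coeff_mapGenFun (g m : ℕ) (k : ℕ+ →₀ ℕ) :
    MvPolynomial.coeff k (PowerSeries.coeff m (mapGenFun g)) =
      ((2 * m).factorial : ℚ)⁻¹ *
        (Finset.card {p ∈ labelledMaps g m | vertexDegrees p.1 = k} : ℚ) := by
  rw [mapGenFun, PowerSeries.coeff_mk, MvPolynomial.coeff_smul, mapPolynomial,
    MvPolynomial.coeff_sum, smul_eq_mul, Finset.card_filter, Nat.cast_sum]
  congr 1
  refine Finset.sum_congr rfl fun p _ => ?_
  rw [vertexWeight_eq, MvPolynomial.coeff_monomial]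
  split_ifs <;> simp

theorem exists_of_coeff_mapGenFun_ne_zero {g m : ℕ} {k : ℕ+ →₀ ℕ}
    (h : MvPolynomial.coeff k (PowerSeries.coeff m (mapGenFun g)) ≠ 0) :
    wt k = 2 * m ∧ g ≤ m + 1 := by
  rw [coeff_mapGenFun] at h
  have h1 := right_ne_zero_of_mul h
  obtain ⟨p, hp⟩ := Finset.card_ne_zero.mp (Nat.cast_ne_zero.mp h1)
  obtain ⟨hp, hk⟩ := Finset.mem_filter.mp hp
  obtain ⟨⟨hα, -⟩, hg⟩ := mem_labelledMaps.mp hp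
  exact ⟨by rw [← hk, wt_vertexDegrees, Fintype.card_fin], genus_le hα hg⟩

theorem finite_coeff_mapGenFun (k : ℕ+ →₀ ℕ) :
    {p : ℕ × ℕ | MvPolynomial.coeff k (PowerSeries.coeff p.2 (mapGenFun p.1)) ≠ 0}.Finite := by
  refine Set.Finite.subset ((Set.finite_Iic (wt k + 1)).prod (Set.finite_Iic (wt k))) ?_
  rintro ⟨g, m⟩ h
  obtain ⟨h1, h2⟩ := exists_of_coeff_mapGenFun_ne_zero h
  exact ⟨Set.mem_Iic.mpr (by dsimp only at *; omega), Set.mem_Iic.mpr (by dsimp only at *; omega)⟩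

theorem finite_genera (m : ℕ) : {g : ℕ | PowerSeries.coeff m (mapGenFun g) ≠ 0}.Finite := by
  refine Set.Finite.subset (Set.finite_Iic (m + 1)) fun g h => ?_
  obtain ⟨k, hk⟩ := MvPolynomial.ne_zero_iff.mp h
  exact Set.mem_Iic.mpr (exists_of_coeff_mapGenFun_ne_zero hk).2

theorem coeff_evalT (t : ℝ) (g m : ℕ) {k : ℕ+ →₀ ℕ} (hk : wt k = 2 * m) :
    MvPowerSeries.coeff k (evalT t (mapGenFun g)) = (t : ℂ) ^ m *
      (((2 * m).factorial : ℂ)⁻¹ *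
        (Finset.card {p ∈ labelledMaps g m | vertexDegrees p.1 = k} : ℂ)) := by
  change (∑ᶠ m : ℕ, _) = _
  rw [finsum_eq_single _ m, coeff_mapGenFun]
  · push_cast
    rfl
  · intro m' hm'
    have h : MvPolynomial.coeff k (PowerSeries.coeff m' (mapGenFun g)) = 0 := by
      by_contra h
      have := (exists_of_coeff_mapGenFun_ne_zero h).1
      omega
    rw [h, Rat.cast_zero, mul_zero]

theorem coeff_evalT_of_odd (t : ℝ) (g : ℕ) {k : ℕ+ →₀ ℕ} (hk : ∀ m, wt k ≠ 2 * m) :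
    MvPowerSeries.coeff k (evalT t (mapGenFun g)) = 0 := by
  change (∑ᶠ m : ℕ, _) = _
  rw [← finsum_zero (α := ℕ)]
  congr 1
  funext m
  have h : MvPolynomial.coeff k (PowerSeries.coeff m (mapGenFun g)) = 0 := by
    by_contra h
    exact hk m (exists_of_coeff_mapGenFun_ne_zero h).1
  rw [h, Rat.cast_zero, mul_zero]

theorem coeff_connectedSum (N : ℕ) (t : ℝ) (m : ℕ) (k : ℕ+ →₀ ℕ) :
    MvPolynomial.coeff k (connectedSum (mapWeight N t) (Fin (2 * m))) = (t : ℂ) ^ m *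
      ∑ g ∈ Finset.range (m + 2), (N : ℂ) ^ (2 - 2 * (g : ℤ)) *
        (Finset.card {p ∈ labelledMaps g m | vertexDegrees p.1 = k} : ℂ) := by
  classical
  have h1 : ∀ g : ℕ, (Finset.card {p ∈ labelledMaps g m | vertexDegrees p.1 = k} : ℂ) =
      ∑ p : Perm (Fin (2 * m)) × Perm (Fin (2 * m)),
        if p ∈ labelledMaps g m ∧ vertexDegrees p.1 = k then 1 else 0 := by
    intro g
    rw [Finset.sum_boole]
    congr 2
    ext p
    simp
  simp only [h1, Finset.mul_sum]
  rw [connectedSum, MvPolynomial.coeff_sum, Finset.sum_filter, Finset.sum_comm]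
  refine Finset.sum_congr rfl fun p _ => ?_
  by_cases hp : (IsPairing p.2 ∧ IsConnectedPair p.1 p.2) ∧ vertexDegrees p.1 = k
  · obtain ⟨⟨hα, hc⟩, hk⟩ := hp
    -- A connected pair has exactly one genus and so appears in exactly one term of the sum over
    -- `g`.
    obtain ⟨g, hg⟩ := exists_genus hα hc
    have hm := hα.two_mul_numCycles
    rw [Fintype.card_fin] at hm
    have hm' : numCycles p.2 = m := by omega
    rw [if_pos hc, Finset.sum_eq_single g]
    · rw [if_pos ⟨mem_labelledMaps.mpr ⟨⟨hα, hc⟩, hg⟩, hk⟩, mapWeight, if_pos hα,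
        MvPolynomial.coeff_monomial, if_pos hk, hg, hm']
      ring
    · intro g' _ hg'
      rw [if_neg, mul_zero, mul_zero]
      rintro ⟨h, -⟩
      have := (mem_labelledMaps.mp h).2
      omega
    · intro h
      exact absurd (Finset.mem_range.mpr (by have := genus_le hα hg; omega)) h
  · rw [Finset.sum_eq_zero fun g _ => by
      rw [if_neg fun h => hp ⟨(mem_labelledMaps.mp h.1).1, h.2⟩, mul_zero, mul_zero]]
    split_ifs with hc
    · rw [mapWeight]
      split_ifs with hα
      · rw [MvPolynomial.coeff_monomial, if_neg fun hk => hp ⟨⟨hα, hc⟩, hk⟩]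
      · exact MvPolynomial.coeff_zero k
    · rfl

/-- Sorting the connected maps by genus. -/
theorem coeff_connectedMapSeries (N : ℕ) (t : ℝ) (k : ℕ+ →₀ ℕ) :
    MvPowerSeries.coeff k (connectedMapSeries N t) = ∑ᶠ g : ℕ, (N : ℂ) ^ (2 - 2 * (g : ℤ)) *
      MvPowerSeries.coeff k (evalT t (mapGenFun g)) := by
  change ((wt k).factorial : ℂ)⁻¹ *
    MvPolynomial.coeff k (connectedSum (mapWeight N t) (Fin (wt k))) = _
  by_cases hk : ∃ m, wt k = 2 * m
  · obtain ⟨m, hm⟩ := hk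
    rw [hm, coeff_connectedSum]
    simp only [coeff_evalT t _ m hm]
    rw [finsum_eq_sum_of_support_subset (s := Finset.range (m + 2)), Finset.mul_sum,
      Finset.mul_sum]
    · exact Finset.sum_congr rfl fun g _ => by ring
    · intro g hg
      rw [Function.mem_support] at hg
      have h := right_ne_zero_of_mul (right_ne_zero_of_mul (right_ne_zero_of_mul hg))
      obtain ⟨p, hp⟩ := Finset.card_ne_zero.mp (Nat.cast_ne_zero.mp h)
      obtain ⟨⟨hα, -⟩, hχ⟩ := mem_labelledMaps.mp (Finset.mem_filter.mp hp).1
      have := genus_le hα hχ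
      exact Finset.mem_coe.mpr (Finset.mem_range.mpr (by omega))
  · push Not at hk
    simp only [coeff_evalT_of_odd t _ hk, mul_zero, finsum_zero]
    rw [connectedSum, MvPolynomial.coeff_sum, Finset.sum_eq_zero, mul_zero]
    intro p _
    rw [mapWeight, if_neg, MvPolynomial.coeff_zero]
    intro hα
    have := hα.two_mul_numCycles
    rw [Fintype.card_fin] at this
    exact hk _ this.symm

end Genera

end OneMatrixModel

end

/-- Topological expansion of the one-matrix model. -/
theorem mainTheorem1 (N : ℕ) (hN : 1 ≤ N) :
    -- the generating functions and their sum over the genus are well defined as formal series: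
    -- a monomial in the `v_n` is met by finitely many genera and powers of `t`, and
    -- a power of `t` by finitely many genera
    (∀ k : ℕ+ →₀ ℕ, {p : ℕ × ℕ | MvPolynomial.coeff k
        (PowerSeries.coeff p.2 (OneMatrixModel.mapGenFun p.1)) ≠ 0}.Finite) ∧
    (∀ m : ℕ, {g : ℕ | PowerSeries.coeff m (OneMatrixModel.mapGenFun g) ≠ 0}.Finite) ∧
    ∀ t : ℝ, 0 < t →
      -- the Gaussian expectation values that define the partition function exist
      IsProbabilityMeasure (OneMatrixModel.gaussianMeasure N t) ∧
      (∀ k : ℕ+ →₀ ℕ, Integrable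
        (fun x => MvPowerSeries.coeff k
          (OneMatrixModel.expTraceV (OneMatrixModel.hermitianOf x)))
        (OneMatrixModel.gaussianMeasure N t)) ∧
      MvPowerSeries.constantCoeff (OneMatrixModel.partitionFunction N t) = 1 ∧
      -- the topological expansion
      ∀ k : ℕ+ →₀ ℕ,
        MvPowerSeries.coeff k (OneMatrixModel.freeEnergy N t) =
          ∑ᶠ g : ℕ, (N : ℂ) ^ (2 - 2 * (g : ℤ)) *
            MvPowerSeries.coeff k (OneMatrixModel.evalT t (OneMatrixModel.mapGenFun g)) := by
  refine ⟨OneMatrixModel.finite_coeff_mapGenFun, OneMatrixModel.finite_genera, fun t ht =>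
    ⟨?_, OneMatrixModel.integrable_coeff_expTraceV hN ht,
      OneMatrixModel.constantCoeff_partitionFunction hN ht, fun k => ?_⟩⟩
  · rw [OneMatrixModel.gaussianMeasure_eq]
    exact OneMatrixModel.isProbabilityMeasure_piGaussian (OneMatrixModel.coordRate_pos hN ht)
  · rw [OneMatrixModel.freeEnergy_eq hN ht, OneMatrixModel.coeff_connectedMapSeries]
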